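/- Let $X$ be a finite set and let $W\colon X\times X\to[0,1]$ be symmetric (a repulsive lattice gas). For $\mathbf w\in\mathbb C^X$ let $$Z_W(\mathbf w)=\sum_{k=0}^\infty\frac1{k!}\sum_{x_1,\dots,x_k\in X}\Big(\prod_{i=1}^k w_{x_i}\Big)\Big(\prod_{1\le i<j\le k}W(x_i,x_j)\Big).$$ This is an entire function with $Z_W(\mathbf 0)=1$, so $\log Z_W$ (with $\log Z_W(\mathbf 0)=0$) is analytic near $\mathbf 0$ and has a Taylor series $\sum_{\mathbf n\in\mathbb N^X}c_{\mathbf n}(W)\,\mathbf w^{\mathbf n}$ around $\mathbf 0$. Let $\mathbf R=(R_x)_{x\in X}$ with $R_x\ge 0$ for all $x$; inequalities between real vectors are componentwise, and $|\mathbf w|\le\mathbf R$ means $|w_x|\le R_x$ for all $x$. The following are equivalent: (a) There is a connected set $C\subseteq(-\infty,0]^X$ containing both $\mathbf 0$ and $-\mathbf R$ such that $Z_W(\mathbf w)>0$ for all $\mathbf w\in C$. [Equivalently, $-\mathbf R$ belongs to the connected component of $Z_W^{-1}(0,\infty)\cap(-\infty,0]^X$ containing $\mathbf 0$.] (b) $Z_W(\mathbf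 w)>0$ for all real $\mathbf w$ with $-\mathbf R\le\mathbf w\le\mathbf 0$. (c) $Z_W(\mathbf w)\ne0$ for all $\mathbf w\in\mathbb C^X$ with $|\mathbf w|\le\mathbf R$. (d) The Taylor series of $\log Z_W$ around $\mathbf 0$ converges at $\mathbf w=-\mathbf R$. [It makes no difference whether this means that the partial sums over some increasing sequence of finite sets of multi-indices that exhausts $\mathbb N^X$ have a limit, or that the series converges unconditionally.] (e) The Taylor series of $\log Z_W$ around $\mathbf 0$ converges absolutely at every $\mathbf w\in\mathbb C^X$ with $|\mathbf w|\le\mathbf R$. Moreover, when these conditions hold, $|Z_W(\mathbf w)|\ge Z_W(-\mathbf R)>0$ for all $\mathbf w\in\mathbb C^X$ with $|\mathbf w|\le\mathbf R$. If in addition $W(x,x)=0$ for all $x\in X$ (hard-core self-repulsion), then (a)–(e) are also equivalent to each of the following: (b$'$) $Z_W(-\mathbf R\,\mathbf 1_S)>0$ for all $S\subseteq X$, where $(\mathbf R\,\mathbf 1_S)_x=R_x$ if $x\in S$ and $0$ otherwise. (f) $Z_W(-\mathbf R)>0$, and $(-1)^{|S|}Z_W(-\mathbf R;S)\ge0$ for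 all $S\subseteq X$, where $$Z_W(\mathbf w;S)=\sum_{S\subseteq X'\subseteq X}\Big(\prod_{x\in X'}w_x\Big)\Big(\prod_{\{x,y\}\subseteq X'}W(x,y)\Big)$$ and the last product runs over the two-element subsets of $X'$. (g) There is a probability measure $P$ on $2^X$ with $P(\emptyset)>0$ and $$\sum_{T\supseteq S}P(T)=\Big(\prod_{x\in S}R_x\Big)\Big(\prod_{\{x,y\}\subseteq S}W(x,y)\Big)\qquad\text{for all }S\subseteq X.$$ The probability measure in (g) is then unique and is given by $P(S)=(-1)^{|S|}Z_W(-\mathbf R;S)$ for all $S\subseteq X$; in particular $P(\emptyset)=Z_W(-\mathbf R)>0$. -/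

import Mathlib

open Filter Topology

/-- A repulsive lattice gas on the single-particle state space `X`: a symmetric two-particle
Boltzmann factor `W` with values in `[0, 1]`. -/
structure RepulsiveLatticeGas (X : Type*) where
  W : X → X → ℝ
  symm : ∀ x y, W x y = W y x
  nonneg : ∀ x y, 0 ≤ W x y
  le_one : ∀ x y, W x y ≤ 1

namespace RepulsiveLatticeGas

/-- The grand partition function
`Z_W(w) = ∑_{k ≥ 0} (1/k!) ∑_{x₁, …, x_k ∈ X} (∏_i w_{x_i}) (∏_{i<j} W(x_i, x_j))`,
for a fugacity vector `w` with entries in `𝕜 = ℝ` or `𝕜 = ℂ`.  The series over `k` converges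
absolutely, because its terms are bounded by those of `exp (∑ x, ‖w x‖)`. -/
noncomputable def Z {X : Type*} [Fintype X] {𝕜 : Type*} [RCLike 𝕜]
    (G : RepulsiveLatticeGas X) (w : X → 𝕜) : 𝕜 :=
  ∑' k : ℕ, ((Nat.factorial k : 𝕜))⁻¹ *
    ∑ x : Fin k → X, (∏ i, w (x i)) *
      ∏ p : Fin k × Fin k with p.1 < p.2, ((G.W (x p.1) (x p.2) : ℝ) : 𝕜)

/-- The product `∏ W(x, y)` over the two-element subsets `{x, y}` of `S`. -/
def pairProd {X : Type*} [DecidableEq X] (G : RepulsiveLatticeGas X) (S : Finset X) : ℝ :=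
  ∏ e ∈ S.sym2 with ¬ e.IsDiag, Sym2.lift ⟨G.W, G.symm⟩ e

/-- `Z_W(w; S) = ∑_{S ⊆ X' ⊆ X} (∏_{x ∈ X'} w_x) (∏_{{x, y} ⊆ X'} W(x, y))`. -/
def ZSup {X : Type*} [Fintype X] [DecidableEq X] (G : RepulsiveLatticeGas X)
    (w : X → ℝ) (S : Finset X) : ℝ :=
  ∑ X' : Finset X with S ⊆ X', (∏ x ∈ X', w x) * G.pairProd X'

/-- `P`, given by its point masses, is a probability measure on the set of subsets of `X` with
`P(∅) > 0` and `∑_{T ⊇ S} P(T) = (∏_{x ∈ S} R_x) (∏_{{x, y} ⊆ S} W(x, y))` for all `S`. -/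
def HasUpperSetMarginals {X : Type*} [Fintype X] [DecidableEq X] (G : RepulsiveLatticeGas X)
    (R : X → ℝ) (P : Finset X → ℝ) : Prop :=
  ((∀ T, 0 ≤ P T) ∧ ∑ T, P T = 1) ∧ 0 < P ∅ ∧
    ∀ S : Finset X, ∑ T : Finset X with S ⊆ T, P T = (∏ x ∈ S, R x) * G.pairProd S

end RepulsiveLatticeGas

/-- The Taylor coefficient at the origin with multi-index `n`,
`(1 / ∏ x, (n x)!) * ∂^{|n|} f / ∏ x, ∂w_x^{n x}` at `w = 0`.  The mixed partial derivative is the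
iterated Fréchet derivative at `0` evaluated at coordinate vectors, the vector of coordinate `x`
occurring `n x` times. -/
noncomputable def taylorCoeff {X : Type*} [Fintype X] [DecidableEq X]
    (f : (X → ℂ) → ℂ) (n : X → ℕ) : ℂ :=
  let l : List X := (∑ x, Multiset.replicate (n x) x).toList
  (∏ x, (Nat.factorial (n x) : ℂ))⁻¹ *
    iteratedFDeriv ℂ l.length f 0 (fun i => Pi.single (l.get i) (1 : ℂ))

/-- The term with multi-index `n` of the Taylor series of `log Z_W` around the origin, at the
point `w`.  Since `Z_W(0) = 1`, the principal logarithm is analytic near `w = 0`. -/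
noncomputable def RepulsiveLatticeGas.logZTerm {X : Type*} [Fintype X] [DecidableEq X]
    (G : RepulsiveLatticeGas X) (w : X → ℂ) (n : X → ℕ) : ℂ :=
  taylorCoeff (fun v : X → ℂ => Complex.log (G.Z v)) n * ∏ x, w x ^ n x

/-- The series `∑ i, a i` converges for some way of summing it: the partial sums over some
increasing sequence of finite sets that exhausts the index set have a limit.  Partial sums over
boxes, partial sums by total degree and all enumerations of the index set are instances. -/
def ConvergesAlongSomeExhaustion {ι : Type*} (a : ι → ℂ) : Prop :=
  ∃ A : ℕ → Finset ι, Monotone A ∧ (∀ i, ∃ k, i ∈ A k) ∧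
    ∃ s : ℂ, Tendsto (fun k => ∑ i ∈ A k, a i) atTop (𝓝 s)

/-!
The argument rests on the identity `∂Z/∂w_x (w) = Z(W(x, ·) w)` (`hasFDerivAt_Z`): placing a
particle at `x` multiplies the fugacities seen by the others by `W(x, ·) ∈ [0, 1]`.

*Real fugacities.* Let `Z > 0` on the box `[-R, 0]`. The identity shows that the partial
derivatives of `Z` on the box are values of `Z` on the same box, hence that `Z` is monotone there
and minimal at the corner `-R`. Consequently the set of corners `-R` whose box has this property
is relatively clopen in `{Z > 0} ∩ (-∞, 0]^X`, so that positivity on a connected set through `0`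
and `-R` gives positivity on the box (`Z_pos_of_connected`).

*Signs.* Put `u(w) = -log Z(-w)`. Then `∂u/∂w_x = E_x` with `E_x(w) = Z(-W(x, ·) w) / Z(-w) = exp
(u(w) - u(W(x, ·) w))`, and `∂E_x/∂w_y (w) = E_x(w) (E_y(w) - W(x, y) E_y(W(x, ·) w))`. Since
damping the variables decreases nonnegative Taylor coefficients, an induction on the order shows
that all Taylor coefficients of `E_x` and of `u` at the origin are nonnegative
(`nonnegJet_negLogZ`).

*Convergence.* On a box where `Z(-w) > 0`, the Taylor polynomials of `E_x` and of `u` are bounded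
by the functions themselves (`taylorPoly_ratio_le`, `taylorPoly_negLogZ_le`). If `T_N E_x ≤ E_x`
for all `x`, then `u - T_{N+1} u` has nonnegative partial derivatives, so that `T_{N+1} u(w) -
T_{N+1} u(W(x, ·) w) ≤ u(w) - u(W(x, ·) w)`; the exponential of the left-hand side dominates
`T_{N+1} E_x` because all coefficients are nonnegative. Bounded partial sums of a series with
nonnegative terms yield absolute convergence at `-R`, hence on the closed polydisc. Wherever the
series converges absolutely its sum is a logarithm of `Z` (`exp_tsum_logZTerm`), so `Z` has no
zero there, and `|Z|` is smallest at `-R` because there every term is nonpositive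
(`Z_neg_le_norm_Z`).

*Hard cores.* If `W(x, x) = 0`, then `W(x, ·) w` has fewer nonzero coordinates than `w` whenever
`w_x ≠ 0`; so the system `∂f/∂w_x (w) = f(W(x, ·) w)` determines `f` from `f(0)`, and `Z` is the
finite sum over sets of particles (`Z_eq_ZSup`). It is affine in each variable, so positivity
needs only be tested at the vertices of the box. The relation `Z(w; S ∪ {x}) = w_x Z(W(x, ·) w;
S)` gives the signs of `Z(-R; S)`, and Möbius inversion on subsets of `X` translates between these
numbers and the probability measure.
-/

set_option linter.unusedSectionVars false

/-! ### The partition function and its gradient -/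

/-- The linear functional `e ↦ ∑ y, c y * e y`. -/
noncomputable def dualVec {X : Type*} [Fintype X] {𝕜 : Type*} [RCLike 𝕜] (c : X → 𝕜) :
    (X → 𝕜) →L[𝕜] 𝕜 :=
  ∑ y, c y • ContinuousLinearMap.proj (R := 𝕜) (φ := fun _ : X => 𝕜) y

/-- The homogeneous polynomial of degree `k` with coefficient `a v` at each ordered monomial
`∏ i, w (v i)`. -/
def homPoly {X : Type*} [Fintype X] {𝕜 : Type*} [RCLike 𝕜] {k : ℕ} (a : (Fin k → X) → 𝕜)
    (w : X → 𝕜) : 𝕜 :=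
  ∑ v, a v * ∏ i, w (v i)

section Poly

variable {X : Type*} [Fintype X] {𝕜 : Type*} [RCLike 𝕜]

@[simp] lemma dualVec_apply (c e : X → 𝕜) : dualVec c e = ∑ y, c y * e y := by
  simp [dualVec]

/-- Termwise differentiation of a series whose derivatives are bounded, near the point `x`, by a
summable sequence. -/
lemma hasFDerivAt_tsum_of_apply {E : Type*} [NormedAddCommGroup E] [NormedSpace 𝕜 E]
    {f : ℕ → E → 𝕜} {f' : ℕ → E → E →L[𝕜] 𝕜} {g' : E →L[𝕜] 𝕜} {u : ℕ → ℝ} {x : E}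
    (hu : Summable u) (hf : ∀ k z, HasFDerivAt (f k) (f' k z) z)
    (hf' : ∀ k, ∀ z ∈ Metric.ball x 1, ∀ e, ‖f' k z e‖ ≤ u k * ‖e‖)
    (hs : Summable fun k => f k x) (hg : ∀ e, HasSum (fun k => f' k x e) (g' e)) :
    HasFDerivAt (fun z => ∑' k, f k z) g' x := by
  let _ : NormedSpace ℝ E := NormedSpace.restrictScalars ℝ 𝕜 E
  have hx : x ∈ Metric.ball x 1 := Metric.mem_ball_self one_pos
  have hb : ∀ k, ∀ z ∈ Metric.ball x 1, ‖f' k z‖ ≤ |u k| := by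
    intro k z hz
    refine ContinuousLinearMap.opNorm_le_bound _ (abs_nonneg _) fun e => (hf' k z hz e).trans ?_
    gcongr
    exact le_abs_self _
  have key := hasFDerivAt_tsum_of_isPreconnected hu.abs Metric.isOpen_ball
    (convex_ball x 1).isPreconnected (fun k z _ => hf k z) hb hx hs hx
  refine key.congr_fderiv ?_
  have hs' : Summable fun k => f' k x := .of_norm_bounded hu.abs fun k => hb k x hx
  ext e
  exact ((ContinuousLinearMap.apply 𝕜 𝕜 e).hasSum hs'.hasSum).unique (hg e)

lemma sum_prod_eq_pow (k : ℕ) (f : X → 𝕜) : ∑ v : Fin k → X, ∏ i, f (v i) = (∑ x, f x) ^ k := by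
  classical
  rw [← Fintype.sum_pow]

lemma norm_homPoly_le {k : ℕ} (a : (Fin k → X) → 𝕜) (C : ℝ) (ha : ∀ v, ‖a v‖ ≤ C)
    (w : X → 𝕜) : ‖homPoly a w‖ ≤ C * (∑ x, ‖w x‖) ^ k := by
  have h := sum_prod_eq_pow k (fun x => ‖w x‖)
  rw [← h, Finset.mul_sum]
  refine (norm_sum_le _ _).trans (Finset.sum_le_sum fun v _ => ?_)
  rw [norm_mul, norm_prod]
  gcongr
  exact ha v

/-- The gradient of a homogeneous polynomial with symmetric coefficients: each of the `k + 1`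
slots contributes the same amount. -/
lemma hasFDerivAt_homPoly {k : ℕ} (a : (Fin (k + 1) → X) → 𝕜) (b : X → (Fin k → X) → 𝕜)
    (h : ∀ (i : Fin (k + 1)) (y : X) (v : Fin k → X), a (i.insertNth y v) = b y v) (w : X → 𝕜) :
    HasFDerivAt (homPoly a) (dualVec fun y => ((k : 𝕜) + 1) * homPoly (b y) w) w := by
  classical
  have h1 : ∀ v : Fin (k + 1) → X, HasFDerivAt (fun w : X → 𝕜 => a v * ∏ i, w (v i))
      (a v • ∑ i, (∏ j ∈ Finset.univ.erase i, w (v j)) •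
        ContinuousLinearMap.proj (R := 𝕜) (φ := fun _ : X => 𝕜) (v i)) w := by
    intro v
    refine HasFDerivAt.const_mul ?_ _
    refine HasFDerivAt.finsetProd fun i _ => ?_
    exact (ContinuousLinearMap.proj (R := 𝕜) (φ := fun _ : X => 𝕜) (v i)).hasFDerivAt
  have h2 := HasFDerivAt.fun_sum (u := Finset.univ) fun v _ => h1 v
  refine h2.congr_fderiv ?_
  ext e
  simp only [dualVec_apply, sum_apply, smul_apply, ContinuousLinearMap.proj_apply, smul_eq_mul,
    Finset.mul_sum]
  rw [Finset.sum_comm]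
  have h3 : ∀ i : Fin (k + 1), ∑ v : Fin (k + 1) → X,
      a v * ((∏ j ∈ Finset.univ.erase i, w (v j)) * e (v i)) =
      ∑ y, homPoly (b y) w * e y := by
    intro i
    rw [← (Fin.insertNthEquiv (fun _ => X) i).sum_comp, Fintype.sum_prod_type]
    refine Finset.sum_congr rfl fun y _ => ?_
    rw [homPoly, Finset.sum_mul]
    refine Finset.sum_congr rfl fun v _ => ?_
    have h4 : Finset.univ.erase i = Finset.univ.map (Fin.succAboveEmb i) := by
      ext j
      simp [Fin.exists_succAbove_eq_iff]
    rw [h4, Finset.prod_map]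
    simp [Fin.insertNthEquiv, h, mul_assoc]
  rw [Finset.sum_congr rfl fun i _ => h3 i]
  simp [Finset.mul_sum, mul_assoc]

end Poly

namespace RepulsiveLatticeGas

/-- The fugacity vector `W(x, ·) w`: the effective fugacities seen by the other particles once a
particle has been placed at `x`. -/
def damp {X : Type*} {𝕜 : Type*} [RCLike 𝕜] (G : RepulsiveLatticeGas X) (x : X) (w : X → 𝕜) :
    X → 𝕜 :=
  fun y => (G.W x y : 𝕜) * w y

/-- The Boltzmann weight `∏_{i < j} W(v i, v j)` of a configuration `v` of `k` labelled
particles. -/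
def weight {X : Type*} (𝕜 : Type*) [RCLike 𝕜] (G : RepulsiveLatticeGas X) {k : ℕ}
    (v : Fin k → X) : 𝕜 :=
  ∏ p : Fin k × Fin k with p.1 < p.2, ((G.W (v p.1) (v p.2) : ℝ) : 𝕜)

variable {X : Type*} {𝕜 : Type*} [RCLike 𝕜] (G : RepulsiveLatticeGas X)

lemma norm_W_le (x y : X) : ‖(G.W x y : 𝕜)‖ ≤ 1 := by
  rw [RCLike.norm_ofReal, abs_of_nonneg (G.nonneg x y)]
  exact G.le_one x y

lemma norm_weight_le {k : ℕ} (v : Fin k → X) : ‖G.weight 𝕜 v‖ ≤ 1 := by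
  rw [weight, norm_prod]
  exact Finset.prod_le_one (fun _ _ => norm_nonneg _) fun p _ => G.norm_W_le _ _

lemma weight_eq {k : ℕ} (v : Fin k → X) : G.weight 𝕜 v =
    ∏ p : Fin k, ∏ q : Fin k, if p < q then (G.W (v p) (v q) : 𝕜) else 1 := by
  rw [weight, Finset.prod_filter, Fintype.prod_prod_type]

/-- Adding a particle at `y`, with any label, multiplies the weight by its interactions. -/
lemma weight_insertNth {k : ℕ} (i : Fin (k + 1)) (y : X) (v : Fin k → X) :
    G.weight 𝕜 (i.insertNth y v : Fin (k + 1) → X) = (∏ j, (G.W y (v j) : 𝕜)) * G.weight 𝕜 v := by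
  rw [weight_eq, weight_eq, Fin.prod_univ_succAbove _ i, Fin.prod_univ_succAbove _ i]
  simp_rw [Fin.prod_univ_succAbove _ i, Finset.prod_mul_distrib]
  simp only [lt_self_iff_false, if_false, one_mul, Fin.insertNth_apply_same,
    Fin.insertNth_apply_succAbove, Fin.succAbove_lt_succAbove_iff, ← mul_assoc]
  congr 1
  rw [← Finset.prod_mul_distrib]
  refine Finset.prod_congr rfl fun j _ => ?_
  rcases lt_or_gt_of_ne (Fin.succAbove_ne i j) with h | h
  · simp [h, h.not_gt, G.symm]
  · simp [h, h.not_gt]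

variable [Fintype X]

/-- The contribution of the configurations of `k` particles to `Z`. -/
noncomputable def sector (k : ℕ) (w : X → 𝕜) : 𝕜 :=
  ((Nat.factorial k : 𝕜))⁻¹ * homPoly (G.weight 𝕜 (k := k)) w

lemma Z_eq_tsum (w : X → 𝕜) : G.Z w = ∑' k : ℕ, G.sector k w := by
  simp only [Z, sector, homPoly, weight, mul_comm]

lemma norm_sector_le (k : ℕ) (w : X → 𝕜) :
    ‖G.sector k w‖ ≤ (∑ x, ‖w x‖) ^ k / (Nat.factorial k) := by
  rw [sector, norm_mul, norm_inv, RCLike.norm_natCast, div_eq_inv_mul]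
  gcongr
  simpa using norm_homPoly_le (G.weight 𝕜 (k := k)) 1 G.norm_weight_le w

lemma summable_sector (w : X → 𝕜) : Summable fun k : ℕ => G.sector k w :=
  Summable.of_norm_bounded (Real.summable_pow_div_factorial (∑ x, ‖w x‖))
    fun k => G.norm_sector_le k w

lemma sector_zero (w : X → 𝕜) : G.sector 0 w = 1 := by
  simp [sector, homPoly, weight]

lemma Z_eq_one_add (w : X → 𝕜) : G.Z w = 1 + ∑' k, G.sector (k + 1) w := by
  rw [G.Z_eq_tsum w, (G.summable_sector w).tsum_eq_zero_add, sector_zero]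

lemma homPoly_damp {k : ℕ} (x : X) (w : X → 𝕜) :
    homPoly (fun v : Fin k → X => (∏ j, (G.W x (v j) : 𝕜)) * G.weight 𝕜 v) w =
      homPoly (G.weight 𝕜 (k := k)) (G.damp x w) := by
  simp only [homPoly, damp, Finset.prod_mul_distrib]
  exact Finset.sum_congr rfl fun v _ => by ring

lemma hasFDerivAt_sector_succ (k : ℕ) (w : X → 𝕜) :
    HasFDerivAt (G.sector (k + 1)) (dualVec fun x => G.sector k (G.damp x w)) w := by
  refine (HasFDerivAt.const_mul (hasFDerivAt_homPoly _ _ (G.weight_insertNth (𝕜 := 𝕜)) w)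
    _).congr_fderiv ?_
  ext e
  simp only [sector, smul_apply, dualVec_apply, smul_eq_mul, Finset.mul_sum, homPoly_damp]
  refine Finset.sum_congr rfl fun y _ => ?_
  have : (k : 𝕜) + 1 ≠ 0 := by exact_mod_cast Nat.succ_ne_zero k
  have h' : (Nat.factorial k : 𝕜) ≠ 0 := by exact_mod_cast Nat.factorial_ne_zero k
  rw [Nat.factorial_succ]
  push_cast
  field_simp

lemma sum_norm_damp_le (x : X) (w : X → 𝕜) : ∑ y, ‖G.damp x w y‖ ≤ ∑ y, ‖w y‖ := by
  refine Finset.sum_le_sum fun y _ => ?_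
  rw [damp, norm_mul]
  exact mul_le_of_le_one_left (norm_nonneg _) (G.norm_W_le x y)

/-- The identity `∂Z/∂w_x (w) = Z(W(x, ·) w)`, on which the whole argument rests. -/
theorem hasFDerivAt_Z (w : X → 𝕜) :
    HasFDerivAt (fun w : X → 𝕜 => G.Z w) (dualVec fun x => G.Z (G.damp x w)) w := by
  have hZ : (fun w : X → 𝕜 => G.Z w) = fun w => 1 + ∑' k, G.sector (k + 1) w :=
    funext G.Z_eq_one_add
  rw [hZ]
  refine HasFDerivAt.const_add 1 ?_
  refine hasFDerivAt_tsum_of_apply (u := fun k : ℕ => (Fintype.card X : ℝ) *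
    ((Fintype.card X * (‖w‖ + 1)) ^ k / (Nat.factorial k)))
    ((Real.summable_pow_div_factorial _).mul_left _)
    (fun k v => G.hasFDerivAt_sector_succ k v) ?_ ?_ ?_
  · intro k v hv e
    have hr : ∑ x, ‖v x‖ ≤ Fintype.card X * (‖w‖ + 1) := by
      refine (Finset.sum_le_card_nsmul _ _ (‖w‖ + 1) fun x _ => ?_).trans
        (by rw [nsmul_eq_mul, Finset.card_univ])
      refine (norm_le_pi_norm v x).trans ?_
      have := norm_sub_norm_le v w
      rw [mem_ball_iff_norm] at hv
      linarith
    rw [dualVec_apply]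
    refine (norm_sum_le _ _).trans ?_
    refine (Finset.sum_le_card_nsmul _ _
      ((Fintype.card X * (‖w‖ + 1)) ^ k / (Nat.factorial k) * ‖e‖) fun x _ => ?_).trans
      (by rw [nsmul_eq_mul, Finset.card_univ, mul_assoc])
    rw [norm_mul]
    gcongr
    · refine (G.norm_sector_le _ _).trans ?_
      gcongr
      exact (G.sum_norm_damp_le x v).trans hr
    · exact norm_le_pi_norm e x
  · exact (summable_nat_add_iff (f := fun k => G.sector k w) 1).2 (G.summable_sector w)
  · intro e
    simp only [dualVec_apply]
    refine hasSum_sum fun x _ => HasSum.mul_right _ ?_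
    rw [Z_eq_tsum]
    exact (G.summable_sector _).hasSum

end RepulsiveLatticeGas

/-! ### Positivity along connected sets and on boxes -/

/-- A function on a box of `ℝ^X` with nonnegative partial derivatives is monotone. -/
lemma le_of_gradient_nonneg {X : Type*} [Fintype X] {F : (X → ℝ) → ℝ} {c : (X → ℝ) → X → ℝ}
    {a b : X → ℝ} (hab : a ≤ b) (hF : ∀ v ∈ Set.Icc a b, HasFDerivAt F (dualVec (c v)) v)
    (hc : ∀ v ∈ Set.Icc a b, ∀ y, 0 ≤ c v y) : F a ≤ F b := by
  obtain ⟨z, hz, h⟩ := domain_mvt (fun v hv => (hF v hv).hasFDerivWithinAt) (convex_Icc a b)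
    (Set.left_mem_Icc.2 hab) (Set.right_mem_Icc.2 hab)
  rw [← sub_nonneg, h, dualVec_apply]
  have hz' : z ∈ Set.Icc a b := segment_subset_Icc hab hz
  exact Finset.sum_nonneg fun y _ => mul_nonneg (hc z hz' y) (sub_nonneg.2 (hab y))

lemma forall_Icc_neg_iff {X : Type*} {R : X → ℝ} {p : (X → ℝ) → Prop} :
    (∀ w ∈ Set.Icc (-R) 0, p w) ↔ ∀ w ∈ Set.Icc 0 R, p (-w) := by
  constructor
  · intro h w hw
    exact h _ ⟨neg_le_neg hw.2, neg_nonpos.2 hw.1⟩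
  · intro h w hw
    simpa using h (-w) ⟨neg_nonneg.2 hw.2, neg_le.1 hw.1⟩

namespace RepulsiveLatticeGas

section Basic

variable {X : Type*} {𝕜 : Type*} [RCLike 𝕜] (G : RepulsiveLatticeGas X)

lemma damp_zero (x : X) : G.damp x (0 : X → 𝕜) = 0 := by
  ext; simp [damp]

lemma damp_neg (x : X) (w : X → 𝕜) : G.damp x (-w) = -G.damp x w := by
  ext; simp [damp]

lemma damp_mem_Icc {x : X} {w R : X → ℝ} (hw : w ∈ Set.Icc 0 R) :
    G.damp x w ∈ Set.Icc 0 w :=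
  ⟨fun y => mul_nonneg (G.nonneg x y) (hw.1 y),
    fun y => mul_le_of_le_one_left (hw.1 y) (G.le_one x y)⟩

lemma damp_mem_Icc' {x : X} {w R : X → ℝ} (hw : w ∈ Set.Icc 0 R) : G.damp x w ∈ Set.Icc 0 R :=
  ⟨(G.damp_mem_Icc hw).1, (G.damp_mem_Icc hw).2.trans hw.2⟩

variable [Fintype X]

@[simp] lemma Z_zero : G.Z (0 : X → 𝕜) = 1 := by
  rw [Z_eq_one_add, add_eq_left]
  convert tsum_zero with k
  simp [sector, homPoly]

lemma Z_ofReal (w : X → ℝ) : G.Z (fun x => (w x : ℂ)) = (G.Z w : ℝ) := by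
  rw [Z, Z, Complex.ofReal_tsum]
  refine tsum_congr fun k => ?_
  push_cast
  rfl

lemma continuous_Z : Continuous fun w : X → 𝕜 => G.Z w :=
  continuous_iff_continuousAt.2 fun w => (G.hasFDerivAt_Z w).continuousAt

lemma contDiff_damp {n : WithTop ℕ∞} (x : X) : ContDiff 𝕜 n fun w : X → 𝕜 => G.damp x w := by
  unfold damp; fun_prop

open scoped ContDiff in
lemma contDiff_Z : ContDiff 𝕜 ∞ fun w : X → 𝕜 => G.Z w := by
  rw [contDiff_infty]
  intro n
  induction n with
  | zero => exact contDiff_zero.2 G.continuous_Z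
  | succ n ih =>
    refine (contDiff_succ_iff_hasFDerivAt (n := n)).2 ⟨_, ?_, G.hasFDerivAt_Z⟩
    unfold dualVec
    exact ContDiff.sum fun x _ => (ih.comp (G.contDiff_damp x)).smul contDiff_const

/-- `∂/∂w_x Z(-w) = -Z(-W(x, ·) w)`. -/
lemma hasFDerivAt_Z_neg (w : X → 𝕜) :
    HasFDerivAt (fun w : X → 𝕜 => G.Z (-w)) (dualVec fun x => -G.Z (-G.damp x w)) w := by
  have h := (G.hasFDerivAt_Z (-w)).comp w (hasFDerivAt_id w).neg
  refine h.congr_fderiv ?_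
  ext e
  simp [dualVec_apply, damp_neg]

lemma hasFDerivAt_comp_damp {f : (X → 𝕜) → 𝕜} {c : X → 𝕜} (x : X) {w : X → 𝕜}
    (hf : HasFDerivAt f (dualVec c) (G.damp x w)) :
    HasFDerivAt (fun w => f (G.damp x w)) (dualVec fun y => G.W x y * c y) w := by
  have hd : HasFDerivAt (fun w : X → 𝕜 => G.damp x w)
      (ContinuousLinearMap.pi fun y => (G.W x y : 𝕜) •
        ContinuousLinearMap.proj (R := 𝕜) (φ := fun _ : X => 𝕜) y) w := by
    rw [hasFDerivAt_pi]
    intro y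
    exact (ContinuousLinearMap.proj (R := 𝕜) (φ := fun _ : X => 𝕜) y).hasFDerivAt.const_mul _
  refine (hf.comp w hd).congr_fderiv ?_
  ext e
  simp only [ContinuousLinearMap.comp_apply, dualVec_apply, ContinuousLinearMap.pi_apply,
    smul_apply, ContinuousLinearMap.proj_apply, smul_eq_mul]
  exact Finset.sum_congr rfl fun y _ => by ring

end Basic

section Real

variable {X : Type*} [Fintype X] (G : RepulsiveLatticeGas X)

/-- On a box `[-R, 0]` on which `Z` is positive, `Z` is monotone, because its partial derivatives
are values of `Z` at other points of the box. -/
lemma Z_neg_antitone {R : X → ℝ} (h : ∀ w ∈ Set.Icc 0 R, 0 < G.Z (-w)) {v w : X → ℝ}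
    (hv : 0 ≤ v) (hvw : v ≤ w) (hw : w ≤ R) : G.Z (-w) ≤ G.Z (-v) := by
  have := le_of_gradient_nonneg (F := fun w => -G.Z (-w)) (c := fun w x => G.Z (-G.damp x w)) hvw
    (fun z _ => ((G.hasFDerivAt_Z_neg z).neg).congr_fderiv (by ext; simp))
    (fun z hz y => (h _ (G.damp_mem_Icc' ⟨hv.trans hz.1, hz.2.trans hw⟩)).le)
  linarith

/-- Positivity of `Z` propagates along connected sets of nonpositive fugacities from a point to
the whole box that it spans with the origin: the set of points with that property is relatively
open by compactness, and relatively closed because `Z` is smallest at the corner. -/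
lemma Z_pos_of_connected {R : X → ℝ} (hR : 0 ≤ R) {C : Set (X → ℝ)} (hC : C ⊆ Set.Iic 0)
    (hconn : IsPreconnected C) (h0 : 0 ∈ C) (hRC : -R ∈ C) (hpos : ∀ w ∈ C, 0 < G.Z w) :
    ∀ w ∈ Set.Icc 0 R, 0 < G.Z (-w) := by
  have hcZ := G.continuous_Z (𝕜 := ℝ)
  -- The box `[w ⊓ 0, 0]` is parametrized by the fixed cube `[0, 1]^X`, and `w ⊓ 0` replaces `w` so
  -- that `U` is open in the whole space.
  set U : Set (X → ℝ) := {w | ∀ θ ∈ Set.Icc (0 : X → ℝ) 1, 0 < G.Z (θ * (w ⊓ 0))} with hU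
  have hinf : Continuous fun w : X → ℝ => w ⊓ 0 :=
    continuous_pi fun x => (continuous_apply x).min continuous_const
  have hbox : ∀ {w v : X → ℝ}, v ∈ Set.Icc 0 (-(w ⊓ 0)) →
      ∃ θ ∈ Set.Icc (0 : X → ℝ) 1, -v = θ * (w ⊓ 0) := by
    intro w v hv
    refine ⟨fun x => v x / -(w ⊓ 0) x, ⟨fun x => div_nonneg (hv.1 x) ((hv.1 x).trans (hv.2 x)),
      fun x => div_le_one_of_le₀ (hv.2 x) ((hv.1 x).trans (hv.2 x))⟩, ?_⟩
    ext x
    have h1 := hv.1 x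
    have h2 := hv.2 x
    simp only [Pi.neg_apply, Pi.mul_apply, Pi.zero_apply] at h1 h2 ⊢
    rcases eq_or_ne ((w ⊓ 0) x) 0 with h | h
    · rw [h] at h2 ⊢
      simp only [neg_zero] at h2
      simp [le_antisymm h2 h1]
    · field_simp
  have hUo : IsOpen U := by
    rw [isOpen_iff_eventually]
    intro w hw
    refine (isCompact_Icc (a := (0 : X → ℝ)) (b := 1)).eventually_forall_of_forall_eventually ?_
    intro θ hθ
    have hc : Continuous fun q : (X → ℝ) × (X → ℝ) => G.Z (q.2 * (q.1 ⊓ 0)) :=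
      hcZ.comp (continuous_snd.mul (hinf.comp continuous_fst))
    exact hc.continuousAt.eventually (lt_mem_nhds (hw θ hθ))
  set K : Set (X → ℝ) := {w | ∀ θ ∈ Set.Icc (0 : X → ℝ) 1, G.Z (w ⊓ 0) ≤ G.Z (θ * (w ⊓ 0))}
  have hK : IsClosed K := by
    have : K = ⋂ θ ∈ Set.Icc (0 : X → ℝ) 1, {w | G.Z (w ⊓ 0) ≤ G.Z (θ * (w ⊓ 0))} := by
      ext; simp [K]
    rw [this]
    exact isClosed_biInter fun θ _ => isClosed_le
      (hcZ.comp hinf)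
      (hcZ.comp (continuous_const.mul hinf))
  have hUK : U ⊆ K := by
    intro w hw θ hθ
    have hpos' : ∀ v ∈ Set.Icc 0 (-(w ⊓ 0)), 0 < G.Z (-v) := by
      intro v hv
      obtain ⟨θ, hθ, h⟩ := hbox hv
      rw [h]
      exact hw θ hθ
    have hle : ∀ x, (w ⊓ 0) x ≤ 0 := fun x => inf_le_right
    have := G.Z_neg_antitone hpos' (v := -(θ * (w ⊓ 0))) (w := -(w ⊓ 0))
      (fun x => by
        simpa using mul_nonpos_of_nonneg_of_nonpos (hθ.1 x) (hle x))
      (fun x => by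
        have h1 := hle x
        have h2 : θ x ≤ 1 := hθ.2 x
        simp only [Pi.neg_apply, Pi.mul_apply]
        nlinarith) le_rfl
    simpa only [neg_neg] using this
  have hCU : C ⊆ U := by
    refine hconn.subset_of_closure_inter_subset hUo ⟨0, h0, fun θ _ => by simp⟩ ?_
    rintro w ⟨hw, hwC⟩ θ hθ
    have h1 := (closure_minimal hUK hK hw) θ hθ
    refine lt_of_lt_of_le ?_ h1
    rw [inf_eq_left.2 (hC hwC)]
    exact hpos w hwC
  intro w hw
  have hR' : -R ⊓ 0 = -R := inf_eq_left.2 (neg_nonpos.2 hR)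
  obtain ⟨θ, hθ, h⟩ := hbox (w := -R) (v := w) (by rw [hR', neg_neg]; exact hw)
  rw [h]
  exact hCU hRC θ hθ

end Real

end RepulsiveLatticeGas

/-! ### Mixed partial derivatives at the origin -/

section

open scoped ContDiff ComplexOrder

/-- The partial derivative in the coordinate `x`. -/
noncomputable def partialDeriv {X : Type*} [Fintype X] [DecidableEq X] (x : X)
    (f : (X → ℂ) → ℂ) : (X → ℂ) → ℂ :=
  fun w => fderiv ℂ f w (Pi.single x 1)

/-- The mixed partial derivative of `f` at the origin in the coordinates `v 0, …, v (k - 1)`, with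
the derivative in the last coordinate `v (k - 1)` taken first. -/
noncomputable def jet {X : Type*} [Fintype X] [DecidableEq X] :
    (k : ℕ) → ((X → ℂ) → ℂ) → (Fin k → X) → ℂ
  | 0, f, _ => f 0
  | k + 1, f, v => jet k (partialDeriv (v (Fin.last k)) f) (Fin.init v)

/-- All mixed partial derivatives of `f` at the origin up to order `N` are nonnegative reals. -/
def NonnegJet {X : Type*} [Fintype X] [DecidableEq X] (N : ℕ) (f : (X → ℂ) → ℂ) : Prop :=
  ∀ k ≤ N, ∀ v : Fin k → X, 0 ≤ jet k f v

section Jet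

variable {X : Type*} [Fintype X] [DecidableEq X] {f g : (X → ℂ) → ℂ}

lemma partialDeriv_eq_of_hasFDerivAt {x : X} {w c : X → ℂ} (h : HasFDerivAt f (dualVec c) w) :
    partialDeriv x f w = c x := by
  rw [partialDeriv, h.fderiv, dualVec_apply]
  simp [Pi.single_apply]

lemma hasFDerivAt_dualVec_partialDeriv {w : X → ℂ} (h : DifferentiableAt ℂ f w) :
    HasFDerivAt f (dualVec fun x => partialDeriv x f w) w := by
  refine h.hasFDerivAt.congr_fderiv ?_
  ext e
  rw [dualVec_apply]
  conv_lhs => rw [pi_eq_sum_univ' e]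
  simp only [map_sum, map_smul, smul_eq_mul, partialDeriv]
  exact Finset.sum_congr rfl fun y _ => mul_comm _ _

lemma partialDeriv_congr (h : f =ᶠ[𝓝 0] g) (x : X) :
    partialDeriv x f =ᶠ[𝓝 0] partialDeriv x g := by
  filter_upwards [h.fderiv (𝕜 := ℂ)] with w hw
  rw [partialDeriv, hw, partialDeriv]

lemma jet_congr {k : ℕ} (h : f =ᶠ[𝓝 0] g) (v : Fin k → X) : jet k f v = jet k g v := by
  induction k generalizing f g with
  | zero => exact h.eq_of_nhds
  | succ k ih => exact ih (partialDeriv_congr h _) _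

lemma contDiffAt_partialDeriv (h : ContDiffAt ℂ ∞ f 0) (x : X) :
    ContDiffAt ℂ ∞ (partialDeriv x f) 0 :=
  (h.fderiv_right (m := ∞) (by simp)).clm_apply contDiffAt_const

lemma eventually_differentiableAt (h : ContDiffAt ℂ ∞ f 0) :
    ∀ᶠ w in 𝓝 0, DifferentiableAt ℂ f w := by
  filter_upwards [(h.of_le (m := 1) (by simp)).eventually (by simp)] with w hw
  exact hw.differentiableAt (by simp)

lemma partialDeriv_mul (hf : ContDiffAt ℂ ∞ f 0) (hg : ContDiffAt ℂ ∞ g 0) (x : X) :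
    partialDeriv x (f * g) =ᶠ[𝓝 0] partialDeriv x f * g + f * partialDeriv x g := by
  filter_upwards [eventually_differentiableAt hf, eventually_differentiableAt hg] with w h1 h2
  simp [partialDeriv, fderiv_mul h1 h2]
  ring

lemma partialDeriv_add (hf : ContDiffAt ℂ ∞ f 0) (hg : ContDiffAt ℂ ∞ g 0) (x : X) :
    partialDeriv x (f + g) =ᶠ[𝓝 0] partialDeriv x f + partialDeriv x g := by
  filter_upwards [eventually_differentiableAt hf, eventually_differentiableAt hg] with w h1 h2
  simp [partialDeriv, fderiv_add h1 h2]

lemma partialDeriv_const_mul (c : ℂ) (x : X) :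
    partialDeriv x (fun w => c * f w) = fun w => c * partialDeriv x f w := by
  ext w
  have : (fun w => c * f w) = c • f := rfl
  rw [partialDeriv, this, fderiv_const_smul_field]
  rfl

lemma contDiffAt_comp_mul (hf : ContDiffAt ℂ ∞ f 0) (s : X → ℂ) :
    ContDiffAt ℂ ∞ (fun w => f (s * w)) 0 := by
  refine ContDiffAt.comp (g := f) (f := fun w => s * w) 0 ?_ (by fun_prop)
  simpa using hf

lemma tendsto_mul_zero (s : X → ℂ) : Tendsto (fun w : X → ℂ => s * w) (𝓝 0) (𝓝 0) := by
  have : Continuous fun w : X → ℂ => s * w := by fun_prop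
  simpa using this.tendsto 0

lemma partialDeriv_comp_mul (hf : ContDiffAt ℂ ∞ f 0) (s : X → ℂ) (x : X) :
    partialDeriv x (fun w => f (s * w)) =ᶠ[𝓝 0] fun w => s x * partialDeriv x f (s * w) := by
  filter_upwards [(tendsto_mul_zero s).eventually (eventually_differentiableAt hf)] with w hw
  have hd : HasFDerivAt (fun w : X → ℂ => s * w) (ContinuousLinearMap.mul ℂ (X → ℂ) s) w :=
    (ContinuousLinearMap.mul ℂ (X → ℂ) s).hasFDerivAt
  have h1 : fderiv ℂ (fun w => f (s * w)) w = _ := (hw.hasFDerivAt.comp w hd).fderiv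
  rw [partialDeriv, h1, partialDeriv]
  have : s * Pi.single x (1 : ℂ) = s x • Pi.single x (1 : ℂ) := by
    ext y
    by_cases h : y = x
    · subst h; simp
    · simp [h]
  simp [this]

lemma jet_add {k : ℕ} (hf : ContDiffAt ℂ ∞ f 0) (hg : ContDiffAt ℂ ∞ g 0) (v : Fin k → X) :
    jet k (f + g) v = jet k f v + jet k g v := by
  induction k generalizing f g with
  | zero => rfl
  | succ k ih =>
    rw [jet, jet_congr (partialDeriv_add hf hg _),
      ih (contDiffAt_partialDeriv hf _) (contDiffAt_partialDeriv hg _)]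
    rfl

lemma jet_const_mul {k : ℕ} (c : ℂ) (v : Fin k → X) :
    jet k (fun w => c * f w) v = c * jet k f v := by
  induction k generalizing f with
  | zero => rfl
  | succ k ih => rw [jet, partialDeriv_const_mul, ih, jet]

lemma jet_comp_mul {k : ℕ} (hf : ContDiffAt ℂ ∞ f 0) (s : X → ℂ) (v : Fin k → X) :
    jet k (fun w => f (s * w)) v = (∏ i, s (v i)) * jet k f v := by
  induction k generalizing f with
  | zero => simp [jet]
  | succ k ih =>
    rw [jet, jet_congr (partialDeriv_comp_mul hf s _), jet_const_mul,
      ih (contDiffAt_partialDeriv hf _), jet, Fin.prod_univ_castSucc]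
    simp only [Fin.init]
    ring

lemma partialDeriv_comm (hf : ContDiffAt ℂ ∞ f 0) (x y : X) :
    partialDeriv x (partialDeriv y f) =ᶠ[𝓝 0] partialDeriv y (partialDeriv x f) := by
  filter_upwards [(hf.of_le (m := 2) (WithTop.coe_le_coe.2 le_top)).eventually (by simp)] with w hw
  have hd : DifferentiableAt ℂ (fderiv ℂ f) w :=
    (hw.fderiv_right (m := 1) (by norm_num)).differentiableAt (by simp)
  have key : ∀ x y : X, partialDeriv x (partialDeriv y f) w =
      fderiv ℂ (fderiv ℂ f) w (Pi.single x 1) (Pi.single y 1) := by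
    intro x y
    unfold partialDeriv
    rw [fderiv_clm_apply hd (by fun_prop)]
    simp
  rw [key, key]
  exact hw.isSymmSndFDerivAt (by simp) _ _

/-- Mixed partial derivatives do not depend on the order of differentiation. -/
lemma jet_insertNth {k : ℕ} (hf : ContDiffAt ℂ ∞ f 0) (i : Fin (k + 1)) (y : X) (v : Fin k → X) :
    jet (k + 1) f (i.insertNth y v : Fin (k + 1) → X) = jet k (partialDeriv y f) v := by
  induction k generalizing f with
  | zero =>
    rw [show i = Fin.last 0 from Fin.fin_one_eq_zero i]
    simp [jet]
  | succ k ih =>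
    induction i using Fin.lastCases with
    | last => simp [jet, Fin.insertNth_last']
    | cast i =>
      have h1 : (i.castSucc.insertNth y v : Fin (k + 2) → X) (Fin.last (k + 1)) =
          v (Fin.last k) := by
        have := Fin.insertNth_apply_succAbove (α := fun _ => X) i.castSucc y v (Fin.last k)
        rwa [Fin.succAbove_castSucc_of_le, Fin.succ_last] at this
        exact Fin.le_last i
      have h2 : Fin.init (i.castSucc.insertNth y v : Fin (k + 2) → X) =
          (i.insertNth y (Fin.init v) : Fin (k + 1) → X) := by
        ext j
        rcases Fin.eq_self_or_eq_succAbove i j with rfl | ⟨l, rfl⟩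
        · simp [Fin.init]
        · rw [Fin.insertNth_apply_succAbove, Fin.init, ← Fin.castSucc_succAbove_castSucc,
            Fin.insertNth_apply_succAbove, Fin.init]
      rw [jet, h1, h2, ih (contDiffAt_partialDeriv hf _), jet]
      exact jet_congr (partialDeriv_comm hf _ _) _

/-- The recursive mixed partials are values of the iterated Fréchet derivative. -/
lemma iteratedFDeriv_single {k : ℕ} (hf : ContDiffAt ℂ ∞ f 0) (v : Fin k → X) :
    iteratedFDeriv ℂ k f 0 (fun i => Pi.single (v i) (1 : ℂ)) = jet k f v := by
  induction k generalizing f with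
  | zero => simp [jet]
  | succ k ih =>
    rw [iteratedFDeriv_succ_apply_right, jet, ← ih (contDiffAt_partialDeriv hf _)]
    have h1 : partialDeriv (v (Fin.last k)) f =
      (ContinuousLinearMap.apply ℂ ℂ (Pi.single (v (Fin.last k)) (1 : ℂ))) ∘ (fderiv ℂ f) := rfl
    rw [h1, ContinuousLinearMap.iteratedFDeriv_comp_left _
      (hf.fderiv_right (m := ∞) (by simp)) (by exact_mod_cast le_top)]
    rfl

end Jet

end

/-! ### Taylor polynomials with nonnegative coefficients -/

section

open scoped ContDiff ComplexOrder

/-- The Taylor polynomial of degree `N` at the origin of the real part of `f`, as a function on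
`ℝ^X`. -/
noncomputable def taylorPoly {X : Type*} [Fintype X] [DecidableEq X] (N : ℕ)
    (f : (X → ℂ) → ℂ) (w : X → ℝ) : ℝ :=
  ∑ k ∈ Finset.range (N + 1), (Nat.factorial k : ℝ)⁻¹ * homPoly (fun v => (jet k f v).re) w

/-- The function `f(w) - c f(s w)`, with `s w` the coordinatewise product. -/
def dilationDiff {X : Type*} (c : ℝ) (s : X → ℝ) (f : (X → ℂ) → ℂ) : (X → ℂ) → ℂ :=
  f + fun w => (-c : ℂ) * f ((fun x => (s x : ℂ)) * w)

section Taylor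

variable {X : Type*} [Fintype X] [DecidableEq X] {f g : (X → ℂ) → ℂ} {N : ℕ}

lemma nonnegJet_succ : NonnegJet (N + 1) f ↔ 0 ≤ f 0 ∧ ∀ x, NonnegJet N (partialDeriv x f) := by
  constructor
  · refine fun h => ⟨h 0 (Nat.zero_le _) Fin.elim0, fun x k hk v => ?_⟩
    simpa [jet] using h (k + 1) (by lia) (Fin.snoc v x : Fin (k + 1) → X)
  · rintro ⟨h0, h⟩ k hk v
    cases k with
    | zero => exact h0
    | succ k => exact h _ k (by lia) _

lemma NonnegJet.congr (h : NonnegJet N f) (hfg : f =ᶠ[𝓝 0] g) : NonnegJet N g :=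
  fun k hk v => by rw [← jet_congr hfg]; exact h k hk v

lemma NonnegJet.mono {M : ℕ} (h : NonnegJet N f) (hM : M ≤ N) : NonnegJet M f :=
  fun k hk v => h k (hk.trans hM) v

lemma NonnegJet.add (hf : NonnegJet N f) (hg : NonnegJet N g) (hf' : ContDiffAt ℂ ∞ f 0)
    (hg' : ContDiffAt ℂ ∞ g 0) : NonnegJet N (f + g) := fun k hk v => by
  rw [jet_add hf' hg']
  exact add_nonneg (hf k hk v) (hg k hk v)

lemma NonnegJet.mul (hf : NonnegJet N f) (hg : NonnegJet N g) (hf' : ContDiffAt ℂ ∞ f 0)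
    (hg' : ContDiffAt ℂ ∞ g 0) : NonnegJet N (f * g) := by
  induction N generalizing f g with
  | zero =>
    intro k hk v
    obtain rfl : k = 0 := by lia
    exact mul_nonneg (hf 0 le_rfl v) (hg 0 le_rfl v)
  | succ N ih =>
    have hf2 := nonnegJet_succ.1 hf
    have hg2 := nonnegJet_succ.1 hg
    refine nonnegJet_succ.2 ⟨mul_nonneg hf2.1 hg2.1, fun x => ?_⟩
    refine NonnegJet.congr ?_ (partialDeriv_mul hf' hg' x).symm
    have h1 := contDiffAt_partialDeriv hf' x
    have h2 := contDiffAt_partialDeriv hg' x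
    exact (ih (hf2.2 x) (hg.mono N.le_succ) h1 hg').add
      (ih (hf.mono N.le_succ) (hg2.2 x) hf' h2) (h1.mul hg') (hf'.mul h2)

lemma contDiffAt_dilationDiff (hf : ContDiffAt ℂ ∞ f 0) (c : ℝ) (s : X → ℝ) :
    ContDiffAt ℂ ∞ (dilationDiff c s f) 0 :=
  hf.add (contDiffAt_const.mul (contDiffAt_comp_mul hf _))

lemma jet_dilationDiff {k : ℕ} (hf : ContDiffAt ℂ ∞ f 0) (c : ℝ) (s : X → ℝ) (v : Fin k → X) :
    jet k (dilationDiff c s f) v = ((1 - c * ∏ i, s (v i) : ℝ) : ℂ) * jet k f v := by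
  rw [dilationDiff, jet_add hf (contDiffAt_const.mul (contDiffAt_comp_mul hf _)), jet_const_mul,
    jet_comp_mul hf]
  push_cast
  ring

/-- Damping the variables decreases the derivatives at the origin. -/
lemma NonnegJet.dilationDiff (hf : NonnegJet N f) (hf' : ContDiffAt ℂ ∞ f 0) {c : ℝ}
    {s : X → ℝ} (hc : c ≤ 1) (hs0 : ∀ x, 0 ≤ s x) (hs : ∀ x, s x ≤ 1) :
    NonnegJet N (dilationDiff c s f) := fun k hk v => by
  rw [jet_dilationDiff hf']
  refine mul_nonneg ?_ (hf k hk v)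
  rw [← Complex.ofReal_zero, Complex.real_le_real, sub_nonneg]
  exact mul_le_one₀ hc (Finset.prod_nonneg fun i _ => hs0 _)
    (Finset.prod_le_one (fun _ _ => hs0 _) fun _ _ => hs _)

lemma homPoly_zero_of_pos {k : ℕ} (a : (Fin (k + 1) → X) → ℝ) : homPoly a 0 = 0 := by
  simp [homPoly]

lemma taylorPoly_degree_zero (w : X → ℝ) : taylorPoly 0 f w = (f 0).re := by
  simp [taylorPoly, homPoly, jet]

lemma taylorPoly_zero : taylorPoly N f 0 = (f 0).re := by
  rw [taylorPoly, Finset.sum_range_succ', Finset.sum_eq_zero]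
  · simp [homPoly, jet]
  · intro k _
    rw [homPoly_zero_of_pos, mul_zero]

lemma taylorPoly_congr (h : f =ᶠ[𝓝 0] g) : taylorPoly N f = taylorPoly N g := by
  ext w
  simp only [taylorPoly, jet_congr h]

lemma taylorPoly_add (hf : ContDiffAt ℂ ∞ f 0) (hg : ContDiffAt ℂ ∞ g 0) (w : X → ℝ) :
    taylorPoly N (f + g) w = taylorPoly N f w + taylorPoly N g w := by
  simp only [taylorPoly, jet_add hf hg, homPoly, Complex.add_re, add_mul, mul_add,
    Finset.sum_add_distrib]

lemma taylorPoly_dilationDiff (hf : ContDiffAt ℂ ∞ f 0) (c : ℝ) (s w : X → ℝ) :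
    taylorPoly N (dilationDiff c s f) w = taylorPoly N f w - c * taylorPoly N f (s * w) := by
  simp only [taylorPoly, jet_dilationDiff hf, homPoly, Complex.re_ofReal_mul, Finset.mul_sum,
    ← Finset.sum_sub_distrib, Pi.mul_apply, Finset.prod_mul_distrib]
  refine Finset.sum_congr rfl fun k _ => Finset.sum_congr rfl fun v _ => by ring

/-- The gradient of a Taylor polynomial consists of Taylor polynomials of the gradient. -/
lemma hasFDerivAt_taylorPoly (hf : ContDiffAt ℂ ∞ f 0) (w : X → ℝ) :
    HasFDerivAt (taylorPoly (N + 1) f)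
      (dualVec fun y => taylorPoly N (partialDeriv y f) w) w := by
  have h : taylorPoly (N + 1) f = fun w => (∑ k ∈ Finset.range (N + 1),
      (Nat.factorial (k + 1) : ℝ)⁻¹ * homPoly (fun v => (jet (k + 1) f v).re) w) +
        (f 0).re := by
    ext w
    rw [taylorPoly, Finset.sum_range_succ']
    simp [homPoly, jet]
  rw [h]
  refine HasFDerivAt.add_const _ ?_
  have h2 := HasFDerivAt.fun_sum (u := Finset.range (N + 1)) fun k _ =>
    (hasFDerivAt_homPoly (fun v => (jet (k + 1) f v).re)
      (fun y v => (jet k (partialDeriv y f) v).re)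
      (fun i y v => by rw [jet_insertNth hf]) w).const_mul (Nat.factorial (k + 1) : ℝ)⁻¹
  refine h2.congr_fderiv ?_
  ext e
  simp only [sum_apply, smul_apply, dualVec_apply, taylorPoly, smul_eq_mul, Finset.mul_sum,
    Finset.sum_mul]
  rw [Finset.sum_comm]
  refine Finset.sum_congr rfl fun y _ => Finset.sum_congr rfl fun k _ => ?_
  rw [Nat.factorial_succ]
  push_cast
  have : (Nat.factorial k : ℝ) ≠ 0 := by positivity
  field_simp

lemma homPoly_nonneg {k : ℕ} {a : (Fin k → X) → ℝ} (ha : ∀ v, 0 ≤ a v) {w : X → ℝ}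
    (hw : 0 ≤ w) : 0 ≤ homPoly a w :=
  Finset.sum_nonneg fun v _ => mul_nonneg (ha v) (Finset.prod_nonneg fun _ _ => hw _)

lemma NonnegJet.re_nonneg (hf : NonnegJet N f) {k : ℕ} (hk : k ≤ N) (v : Fin k → X) :
    0 ≤ (jet k f v).re :=
  (Complex.le_def.1 (hf k hk v)).1

lemma taylorPoly_nonneg (hf : NonnegJet N f) {w : X → ℝ} (hw : 0 ≤ w) :
    0 ≤ taylorPoly N f w := by
  refine Finset.sum_nonneg fun k hk => mul_nonneg (by positivity) (homPoly_nonneg ?_ hw)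
  exact hf.re_nonneg (by simpa [Nat.lt_succ_iff] using hk)

lemma taylorPoly_le_succ (hf : NonnegJet (N + 1) f) {w : X → ℝ} (hw : 0 ≤ w) :
    taylorPoly N f w ≤ taylorPoly (N + 1) f w := by
  rw [taylorPoly, taylorPoly, Finset.sum_range_succ _ (N + 1), le_add_iff_nonneg_right]
  exact mul_nonneg (by positivity) (homPoly_nonneg (hf.re_nonneg le_rfl) hw)

/-- Truncating a product of series with nonnegative coefficients discards nonnegative terms of the
product of the truncations. -/
lemma taylorPoly_mul_le (hf : NonnegJet N f) (hg : NonnegJet N g) (hf' : ContDiffAt ℂ ∞ f 0)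
    (hg' : ContDiffAt ℂ ∞ g 0) {w : X → ℝ} (hw : 0 ≤ w) :
    taylorPoly N (f * g) w ≤ taylorPoly N f w * taylorPoly N g w := by
  have hre : ∀ {N : ℕ} {f g : (X → ℂ) → ℂ}, NonnegJet N f → NonnegJet N g →
      ((f * g) 0).re = (f 0).re * (g 0).re := by
    intro N f g hf hg
    have h1 := (Complex.le_def.1 (hf 0 (Nat.zero_le _) Fin.elim0)).2
    simp only [jet, Complex.zero_im] at h1
    simp [← h1]
  induction N generalizing f g w with
  | zero => simp only [taylorPoly_degree_zero]; exact (hre hf hg).le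
  | succ N ih =>
    have hf2 := nonnegJet_succ.1 hf
    have hg2 := nonnegJet_succ.1 hg
    have hfg : ContDiffAt ℂ ∞ (f * g) 0 := hf'.mul hg'
    have key := le_of_gradient_nonneg hw
      (F := fun w => taylorPoly (N + 1) f w * taylorPoly (N + 1) g w - taylorPoly (N + 1) (f * g) w)
      (c := fun v y => taylorPoly (N + 1) f v * taylorPoly N (partialDeriv y g) v +
        taylorPoly (N + 1) g v * taylorPoly N (partialDeriv y f) v -
          taylorPoly N (partialDeriv y (f * g)) v) ?_ ?_
    · simp only [taylorPoly_zero, hre hf hg, sub_self] at key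
      linarith
    · intro v _
      refine (((hasFDerivAt_taylorPoly hf' v).mul (hasFDerivAt_taylorPoly hg' v)).sub
        (hasFDerivAt_taylorPoly hfg v)).congr_fderiv ?_
      ext e
      simp only [sub_apply, add_apply, smul_apply, dualVec_apply, smul_eq_mul, Finset.mul_sum,
        ← Finset.sum_add_distrib, ← Finset.sum_sub_distrib]
      exact Finset.sum_congr rfl fun y _ => by ring
    · intro v hv y
      have h1 := contDiffAt_partialDeriv hf' y
      have h2 := contDiffAt_partialDeriv hg' y
      have h7 : ContDiffAt ℂ ∞ (partialDeriv y f * g) 0 := h1.mul hg'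
      have h8 : ContDiffAt ℂ ∞ (f * partialDeriv y g) 0 := hf'.mul h2
      rw [taylorPoly_congr (partialDeriv_mul hf' hg' y), taylorPoly_add h7 h8]
      have h3 := ih (hf2.2 y) (hg.mono N.le_succ) h1 hg' hv.1
      have h4 := ih (hf.mono N.le_succ) (hg2.2 y) hf' h2 hv.1
      have h5 := mul_le_mul_of_nonneg_left (taylorPoly_le_succ hg hv.1)
        (taylorPoly_nonneg (hf2.2 y) hv.1)
      have h6 := mul_le_mul_of_nonneg_right (taylorPoly_le_succ hf hv.1)
        (taylorPoly_nonneg (hg2.2 y) hv.1)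
      linarith

end Taylor

end

/-! ### The alternating sign property and the domination of Taylor polynomials -/

section

open scoped ContDiff ComplexOrder

namespace RepulsiveLatticeGas

/-- The ratio `Z(-W(x, ·) w) / Z(-w)`: the derivative of `-log Z(-w)` in the coordinate `x`. -/
noncomputable def ratio {X : Type*} [Fintype X] {𝕜 : Type*} [RCLike 𝕜]
    (G : RepulsiveLatticeGas X) (x : X) (w : X → 𝕜) : 𝕜 :=
  G.Z (-G.damp x w) / G.Z (-w)

/-- The analytic germ `-log Z(-w)` at the origin. -/
noncomputable def negLogZ {X : Type*} [Fintype X] (G : RepulsiveLatticeGas X) (w : X → ℂ) : ℂ :=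
  -Complex.log (G.Z (-w))

section Generic

variable {X : Type*} [Fintype X] {𝕜 : Type*} [RCLike 𝕜] (G : RepulsiveLatticeGas X)

/-- The ratios satisfy a closed system of differential equations. -/
lemma hasFDerivAt_ratio {x : X} {w : X → 𝕜} (h : G.Z (-w) ≠ 0) (hx : G.Z (-G.damp x w) ≠ 0) :
    HasFDerivAt (G.ratio x) (dualVec fun y =>
      G.ratio x w * (G.ratio y w - G.W x y * G.ratio y (G.damp x w))) w := by
  have h1 := hasFDerivAt_comp_damp G x (G.hasFDerivAt_Z_neg (G.damp x w))
  have h2 := (hasDerivAt_inv h).comp_hasFDerivAt w (G.hasFDerivAt_Z_neg w)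
  have h3 : G.ratio x = (fun w => G.Z (-G.damp x w)) * (Inv.inv ∘ fun w : X → 𝕜 => G.Z (-w)) := by
    ext w
    exact div_eq_mul_inv _ _
  rw [h3]
  refine (h1.mul h2).congr_fderiv ?_
  ext e
  simp only [Function.comp_apply, add_apply, ← Finset.sum_add_distrib, smul_apply, dualVec_apply,
    smul_eq_mul, Finset.mul_sum, Pi.mul_apply]
  refine Finset.sum_congr rfl fun y _ => ?_
  simp only [ratio]
  field_simp
  ring

end Generic

section Germ

variable {X : Type*} [Fintype X] [DecidableEq X] (G : RepulsiveLatticeGas X)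

lemma eventually_Z_mem_slitPlane : ∀ᶠ w : X → ℂ in 𝓝 0, G.Z (-w) ∈ Complex.slitPlane := by
  have h : Continuous fun w : X → ℂ => G.Z (-w) := G.continuous_Z.comp continuous_neg
  refine h.continuousAt.eventually (Complex.isOpen_slitPlane.mem_nhds ?_)
  simp

lemma eventually_Z_ne_zero : ∀ᶠ w : X → ℂ in 𝓝 0, G.Z (-w) ≠ 0 :=
  G.eventually_Z_mem_slitPlane.mono fun _ h => Complex.slitPlane_ne_zero h

lemma eventually_Z_damp_ne_zero (x : X) : ∀ᶠ w : X → ℂ in 𝓝 0, G.Z (-G.damp x w) ≠ 0 := by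
  have h := (G.contDiff_damp (𝕜 := ℂ) (n := 0) x).continuous.tendsto 0
  rw [damp_zero] at h
  exact h.eventually G.eventually_Z_ne_zero

lemma contDiff_Z_neg : ContDiff ℂ ∞ fun w : X → ℂ => G.Z (-w) := G.contDiff_Z.comp contDiff_neg

lemma contDiffAt_ratio (x : X) : ContDiffAt ℂ ∞ (G.ratio (𝕜 := ℂ) x) 0 := by
  refine ContDiffAt.div ?_ G.contDiff_Z_neg.contDiffAt (by simp)
  exact (G.contDiff_Z_neg.comp (G.contDiff_damp x)).contDiffAt

lemma contDiffAt_negLogZ : ContDiffAt ℂ ∞ G.negLogZ 0 :=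
  (((Complex.contDiffAt_log (by simp)).comp 0 G.contDiff_Z_neg.contDiffAt)).neg

lemma partialDeriv_negLogZ (x : X) : partialDeriv x G.negLogZ =ᶠ[𝓝 0] G.ratio x := by
  filter_upwards [G.eventually_Z_mem_slitPlane] with w hw
  refine partialDeriv_eq_of_hasFDerivAt (c := fun x => G.ratio x w) ?_
  refine ((G.hasFDerivAt_Z_neg w).clog hw).neg.congr_fderiv ?_
  ext e
  simp only [neg_apply, smul_apply, dualVec_apply, smul_eq_mul, Finset.mul_sum,
    ← Finset.sum_neg_distrib, ratio]
  exact Finset.sum_congr rfl fun y _ => by ring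

lemma partialDeriv_ratio (x y : X) : partialDeriv y (G.ratio (𝕜 := ℂ) x) =ᶠ[𝓝 0]
    G.ratio x * dilationDiff (G.W x y) (G.W x) (G.ratio y) := by
  filter_upwards [G.eventually_Z_ne_zero, G.eventually_Z_damp_ne_zero x] with w h hx
  rw [partialDeriv_eq_of_hasFDerivAt (G.hasFDerivAt_ratio h hx)]
  simp only [Pi.mul_apply, dilationDiff, Pi.add_apply, sub_eq_add_neg, neg_mul]
  rfl

lemma ratio_zero (x : X) : G.ratio x (0 : X → ℂ) = 1 := by
  simp [ratio, damp_zero]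

lemma nonnegJet_dilationDiff_ratio {N : ℕ} {x y : X} (h : NonnegJet N (G.ratio (𝕜 := ℂ) y)) :
    NonnegJet N (dilationDiff (G.W x y) (G.W x) (G.ratio y)) :=
  h.dilationDiff (G.contDiffAt_ratio y) (G.le_one x y) (G.nonneg x) (G.le_one x)

lemma nonnegJet_ratio (N : ℕ) (x : X) : NonnegJet N (G.ratio (𝕜 := ℂ) x) := by
  induction N generalizing x with
  | zero =>
    intro k hk v
    obtain rfl : k = 0 := by lia
    simp [jet, ratio_zero]
  | succ N ih =>
    refine nonnegJet_succ.2 ⟨by simp [ratio_zero], fun y => ?_⟩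
    exact NonnegJet.congr ((ih x).mul (G.nonnegJet_dilationDiff_ratio (ih y))
      (G.contDiffAt_ratio x) (contDiffAt_dilationDiff (G.contDiffAt_ratio y) _ _))
      (G.partialDeriv_ratio x y).symm

/-- The Taylor coefficients of `-log Z(-w)` are nonnegative: the alternating sign property of the
Mayer coefficients. -/
lemma nonnegJet_negLogZ (N : ℕ) : NonnegJet N G.negLogZ := by
  cases N with
  | zero =>
    intro k hk v
    obtain rfl : k = 0 := by lia
    simp [jet, negLogZ]
  | succ N =>
    refine nonnegJet_succ.2 ⟨by simp [negLogZ], fun y => ?_⟩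
    exact (G.nonnegJet_ratio N y).congr (G.partialDeriv_negLogZ y).symm

end Germ

section Domination

variable {X : Type*} [Fintype X] [DecidableEq X] (G : RepulsiveLatticeGas X)

lemma exp_log_sub_eq_ratio {R : X → ℝ} (h : ∀ w ∈ Set.Icc 0 R, 0 < G.Z (-w)) {w : X → ℝ}
    (hw : w ∈ Set.Icc 0 R) (x : X) :
    Real.exp (Real.log (G.Z (-G.damp x w)) - Real.log (G.Z (-w))) = G.ratio x w := by
  rw [Real.exp_sub, Real.exp_log (h _ hw), Real.exp_log (h _ (G.damp_mem_Icc' hw)), ratio]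

lemma hasFDerivAt_taylorPoly_negLogZ (N : ℕ) (w : X → ℝ) :
    HasFDerivAt (taylorPoly (N + 1) G.negLogZ)
      (dualVec fun y => taylorPoly N (G.ratio (𝕜 := ℂ) y) w) w := by
  have := hasFDerivAt_taylorPoly (N := N) G.contDiffAt_negLogZ w
  simpa only [taylorPoly_congr (G.partialDeriv_negLogZ _)] using this

/-- If the Taylor polynomials of the partial derivatives of `-log Z(-w)` are bounded by these
derivatives on the box, then the increments of the Taylor polynomial are bounded by those of
`-log Z(-w)`. -/
lemma taylorPoly_negLogZ_sub_le {R : X → ℝ} (h : ∀ w ∈ Set.Icc 0 R, 0 < G.Z (-w)) {N : ℕ}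
    (ih : ∀ x, ∀ w ∈ Set.Icc 0 R, taylorPoly N (G.ratio (𝕜 := ℂ) x) w ≤ G.ratio x w)
    {v w : X → ℝ} (hv : 0 ≤ v) (hvw : v ≤ w) (hw : w ≤ R) :
    taylorPoly (N + 1) G.negLogZ w - taylorPoly (N + 1) G.negLogZ v ≤
      Real.log (G.Z (-v)) - Real.log (G.Z (-w)) := by
  have hbox : Set.Icc v w ⊆ Set.Icc 0 R := Set.Icc_subset_Icc hv hw
  have := le_of_gradient_nonneg (F := fun z => -Real.log (G.Z (-z)) -
      taylorPoly (N + 1) G.negLogZ z)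
    (c := fun z y => G.ratio y z - taylorPoly N (G.ratio (𝕜 := ℂ) y) z) hvw ?_ ?_
  · linarith
  · intro z hz
    refine (((G.hasFDerivAt_Z_neg z).log (h z (hbox hz)).ne').neg.sub
      (G.hasFDerivAt_taylorPoly_negLogZ N z)).congr_fderiv ?_
    ext e
    simp only [sub_apply, neg_apply, smul_apply, dualVec_apply, smul_eq_mul,
      Finset.mul_sum, ← Finset.sum_neg_distrib, ← Finset.sum_sub_distrib, ratio]
    exact Finset.sum_congr rfl fun y _ => by ring
  · exact fun z hz y => sub_nonneg.2 (ih y z (hbox hz))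

/-- The truncation of `exp(u(w) - u(W(x, ·) w))`, where `u(w) = -log Z(-w)`, is bounded by the
exponential of the truncation: the quotient of the two is `1` at the origin and has nonpositive
partial derivatives. -/
lemma taylorPoly_ratio_le_exp (N : ℕ) (x : X) {w : X → ℝ} (hw : 0 ≤ w) :
    taylorPoly (N + 1) (G.ratio (𝕜 := ℂ) x) w ≤
      Real.exp (taylorPoly (N + 1) G.negLogZ w - taylorPoly (N + 1) G.negLogZ (G.damp x w)) := by
  set Q : (X → ℝ) → ℝ := fun w =>
    taylorPoly (N + 1) G.negLogZ w - taylorPoly (N + 1) G.negLogZ (G.damp x w) with hQ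
  set q : (X → ℝ) → X → ℝ := fun w y =>
    taylorPoly N (dilationDiff (G.W x y) (G.W x) (G.ratio y)) w with hq
  have hQd : ∀ w, HasFDerivAt Q (dualVec (q w)) w := by
    intro w
    refine ((G.hasFDerivAt_taylorPoly_negLogZ N w).sub (hasFDerivAt_comp_damp G x
      (G.hasFDerivAt_taylorPoly_negLogZ N (G.damp x w)))).congr_fderiv ?_
    ext e
    simp only [hq, taylorPoly_dilationDiff (G.contDiffAt_ratio _), sub_apply, dualVec_apply,
      ← Finset.sum_sub_distrib, sub_mul]
    rfl
  have key := le_of_gradient_nonneg hw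
    (F := fun w => -(taylorPoly (N + 1) (G.ratio (𝕜 := ℂ) x) w * Real.exp (-Q w)))
    (c := fun w y => Real.exp (-Q w) * (taylorPoly (N + 1) (G.ratio (𝕜 := ℂ) x) w * q w y -
      taylorPoly N (partialDeriv y (G.ratio x)) w)) ?_ ?_
  · simp only [taylorPoly_zero, hQ, damp_zero, sub_self, neg_zero, Real.exp_zero, mul_one,
      ratio_zero, Complex.one_re, neg_le_neg_iff, Real.exp_neg] at key
    rwa [← div_eq_mul_inv, div_le_one (Real.exp_pos _)] at key
  · intro v _
    refine ((hasFDerivAt_taylorPoly (G.contDiffAt_ratio x) v).mul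
      ((hQd v).neg.exp)).neg.congr_fderiv ?_
    ext e
    simp only [neg_apply, add_apply, smul_apply, dualVec_apply, smul_eq_mul, Finset.mul_sum,
      ← Finset.sum_neg_distrib, ← Finset.sum_add_distrib, Pi.neg_apply]
    exact Finset.sum_congr rfl fun y _ => by ring
  · intro v hv y
    refine mul_nonneg (Real.exp_pos _).le (sub_nonneg.2 ?_)
    rw [taylorPoly_congr (G.partialDeriv_ratio x y)]
    have h1 := G.nonnegJet_dilationDiff_ratio (x := x) (G.nonnegJet_ratio N y)
    refine (taylorPoly_mul_le (G.nonnegJet_ratio N x) h1 (G.contDiffAt_ratio x)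
      (contDiffAt_dilationDiff (G.contDiffAt_ratio y) _ _) hv.1).trans ?_
    exact mul_le_mul_of_nonneg_right (taylorPoly_le_succ (G.nonnegJet_ratio _ x) hv.1)
      (taylorPoly_nonneg h1 hv.1)

lemma taylorPoly_ratio_le {R : X → ℝ} (h : ∀ w ∈ Set.Icc 0 R, 0 < G.Z (-w)) (N : ℕ) (x : X) :
    ∀ w ∈ Set.Icc 0 R, taylorPoly N (G.ratio (𝕜 := ℂ) x) w ≤ G.ratio x w := by
  induction N generalizing x with
  | zero =>
    intro w hw
    rw [taylorPoly_degree_zero, ratio_zero, Complex.one_re, ratio, one_le_div (h w hw)]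
    have := G.damp_mem_Icc (x := x) hw
    exact G.Z_neg_antitone h this.1 this.2 hw.2
  | succ N ih =>
    intro w hw
    have := G.damp_mem_Icc (x := x) hw
    refine (G.taylorPoly_ratio_le_exp N x hw.1).trans ?_
    rw [← G.exp_log_sub_eq_ratio h hw x]
    exact Real.exp_le_exp.2 (G.taylorPoly_negLogZ_sub_le h ih this.1 this.2 hw.2)

/-- On a box where `Z(-w)` is positive, all Taylor polynomials of `-log Z(-w)` at the origin are
bounded by `-log Z(-w)`. -/
theorem taylorPoly_negLogZ_le {R : X → ℝ} (hR : 0 ≤ R) (h : ∀ w ∈ Set.Icc 0 R, 0 < G.Z (-w))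
    (N : ℕ) : taylorPoly N G.negLogZ R ≤ -Real.log (G.Z (-R)) := by
  have key := G.taylorPoly_negLogZ_sub_le h (N := N) (G.taylorPoly_ratio_le h N) le_rfl hR le_rfl
  refine (taylorPoly_le_succ (G.nonnegJet_negLogZ _) hR).trans ?_
  rw [taylorPoly_zero] at key
  simpa [negLogZ] using key

end Domination

end RepulsiveLatticeGas

end

/-! ### Taylor coefficients in multi-index form -/

section

open scoped ContDiff ComplexOrder

/-- The multi-index that counts how often each coordinate occurs in `v`. -/
def multiIndex {X : Type*} [DecidableEq X] {k : ℕ} (v : Fin k → X) (x : X) : ℕ :=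
  Finset.card {i | v i = x}

section MultiIndex

variable {X : Type*} [Fintype X] [DecidableEq X]

lemma multiIndex_insertNth {k : ℕ} (i : Fin (k + 1)) (y : X) (v : Fin k → X) :
    multiIndex (i.insertNth y v : Fin (k + 1) → X) = Pi.single y 1 + multiIndex v := by
  ext x
  simp only [multiIndex, Finset.card_filter, Fin.sum_univ_succAbove _ i, Fin.insertNth_apply_same,
    Fin.insertNth_apply_succAbove, Pi.add_apply, Pi.single_apply, eq_comm]

lemma prod_eq_prod_pow_multiIndex {M : Type*} [CommMonoid M] {k : ℕ} (v : Fin k → X) (w : X → M) :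
    ∏ i, w (v i) = ∏ x, w x ^ multiIndex v x := by
  rw [← Finset.prod_fiberwise_of_maps_to (g := v) (t := Finset.univ) (by simp)]
  refine Finset.prod_congr rfl fun x _ => ?_
  rw [Finset.prod_congr rfl (g := fun _ => w x) (by simp +contextual), Finset.prod_const]
  rfl

lemma sum_multiIndex {k : ℕ} (v : Fin k → X) : ∑ x, multiIndex v x = k := by
  simpa [multiIndex] using (Finset.card_eq_sum_card_fiberwise (f := v) (s := Finset.univ)
    (t := Finset.univ)     (by simp [Set.MapsTo])).symm

/-- The multinomial coefficient counts the words with a given multi-index: compare coefficients in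
the two expansions of `(∑ x, X x) ^ k`. -/
lemma card_multiIndex_eq {k : ℕ} {n : X → ℕ} (hn : ∑ x, n x = k) :
    Finset.card {v : Fin k → X | multiIndex v = n} = Nat.multinomial Finset.univ n := by
  have h1 : (∑ x : X, MvPolynomial.X x : MvPolynomial X ℕ) ^ k =
      ∑ v : Fin k → X, ∏ x, MvPolynomial.X x ^ multiIndex v x := by
    rw [Fintype.sum_pow]
    exact Finset.sum_congr rfl fun v _ => prod_eq_prod_pow_multiIndex v _
  rw [Finset.sum_pow_eq_sum_piAntidiag] at h1
  have hmon : ∀ m : X → ℕ, (∏ x, MvPolynomial.X x ^ m x : MvPolynomial X ℕ) =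
      MvPolynomial.monomial (Finsupp.equivFunOnFinite.symm m) 1 := by
    intro m
    rw [MvPolynomial.monomial_eq, Finsupp.prod_fintype _ _ (by simp)]
    simp
  have h2 := congrArg (MvPolynomial.coeff (Finsupp.equivFunOnFinite.symm n)) h1
  simp only [hmon, MvPolynomial.coeff_sum, MvPolynomial.coeff_monomial,
    EmbeddingLike.apply_eq_iff_eq, ← Finset.card_filter] at h2
  rw [← h2, Finset.sum_eq_single n]
  · rw [← nsmul_eq_mul, MvPolynomial.coeff_smul]
    simp
  · intro m _ hm
    rw [← nsmul_eq_mul, MvPolynomial.coeff_smul]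
    simp [hm]
  · intro h
    simp [hn] at h

/-- Mixed partial derivatives depend only on the multi-index. -/
lemma jet_eq_of_multiIndex_eq {k : ℕ} {f : (X → ℂ) → ℂ} (hf : ContDiffAt ℂ ∞ f 0)
    {v v' : Fin k → X} (h : multiIndex v = multiIndex v') : jet k f v = jet k f v' := by
  induction k generalizing f with
  | zero => rfl
  | succ k ih =>
    obtain ⟨i, hi⟩ : ∃ i, v' i = v (Fin.last k) := by
      have h1 : 0 < multiIndex v (v (Fin.last k)) :=
        Finset.card_pos.2 ⟨Fin.last k, by simp⟩
      rw [h] at h1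
      obtain ⟨i, hi⟩ := Finset.card_pos.1 h1
      exact ⟨i, by simpa using hi⟩
    have hv : v = (Fin.last k).insertNth (v (Fin.last k)) (Fin.init v) := by
      simp [Fin.insertNth_last']
    have hv' : v' = i.insertNth (v (Fin.last k)) (i.removeNth v') := by
      rw [← hi, Fin.insertNth_self_removeNth]
    rw [hv, hv'] at h
    rw [multiIndex_insertNth, multiIndex_insertNth, add_right_inj] at h
    rw [hv, hv', jet_insertNth hf, jet_insertNth hf]
    exact ih (contDiffAt_partialDeriv hf _) h

end MultiIndex

section TaylorCoeff

variable {X : Type*} [Fintype X] [DecidableEq X] {f : (X → ℂ) → ℂ}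

lemma multiIndex_listGet (n : X → ℕ) :
    multiIndex (∑ x, Multiset.replicate (n x) x).toList.get = n := by
  ext x
  set l := (∑ x, Multiset.replicate (n x) x).toList with hl
  have h1 : l.count x = n x := by
    rw [← Multiset.coe_count, hl, Multiset.coe_toList, Multiset.count_sum']
    simp [Multiset.count_replicate]
  have h2 : (l : Multiset X) = Finset.univ.val.map l.get := by
    rw [Fin.univ_val_map, List.ofFn_get]
  rw [← h1, ← Multiset.coe_count, h2, Multiset.count_map]
  simp only [eq_comm (a := x)]
  rfl

lemma taylorCoeff_eq {k : ℕ} (hf : ContDiffAt ℂ ∞ f 0) (v : Fin k → X) :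
    taylorCoeff f (multiIndex v) = (∏ x, (Nat.factorial (multiIndex v x) : ℂ))⁻¹ * jet k f v := by
  simp only [taylorCoeff]
  congr 1
  rw [iteratedFDeriv_single hf]
  have h1 := multiIndex_listGet (multiIndex v)
  have h2 : (∑ x, Multiset.replicate (multiIndex v x) x).toList.length = k := by
    have := sum_multiIndex (∑ x, Multiset.replicate (multiIndex v x) x).toList.get
    rw [h1, sum_multiIndex] at this
    exact this.symm
  revert h1 h2
  generalize (∑ x, Multiset.replicate (multiIndex v x) x).toList = l
  rintro h1 rfl
  exact jet_eq_of_multiIndex_eq hf h1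

lemma exists_multiIndex_eq (n : X → ℕ) : ∃ v : Fin (∑ x, n x) → X, multiIndex v = n := by
  have h := multiIndex_listGet n
  have h2 := sum_multiIndex (∑ x, Multiset.replicate (n x) x).toList.get
  rw [h] at h2
  rw [h2]
  exact ⟨_, h⟩

/-- The homogeneous part of degree `k` of the Taylor series, in multi-index form. -/
lemma homPoly_jet_eq_sum (hf : ContDiffAt ℂ ∞ f 0) (k : ℕ) (w : X → ℂ) :
    (Nat.factorial k : ℂ)⁻¹ * homPoly (jet k f) w =
      ∑ n ∈ Finset.piAntidiag Finset.univ k, taylorCoeff f n * ∏ x, w x ^ n x := by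
  rw [homPoly, ← Finset.sum_fiberwise_of_maps_to (g := multiIndex)
    (t := Finset.piAntidiag Finset.univ k) (by simp [sum_multiIndex]), Finset.mul_sum]
  refine Finset.sum_congr rfl fun n hn => ?_
  have hn' : ∑ x, n x = k := by simpa using hn
  have h1 : ∀ v ∈ Finset.univ.filter (fun v : Fin k → X => multiIndex v = n),
      jet k f v * ∏ i, w (v i) =
        (∏ x, (Nat.factorial (n x) : ℂ)) * (taylorCoeff f n * ∏ x, w x ^ n x) := by
    intro v hv
    obtain rfl : multiIndex v = n := by simpa using hv
    have h0 : (∏ x, (Nat.factorial (multiIndex v x) : ℂ)) ≠ 0 :=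
      Finset.prod_ne_zero_iff.2 fun x _ => by exact_mod_cast Nat.factorial_ne_zero _
    rw [taylorCoeff_eq hf, prod_eq_prod_pow_multiIndex]
    field_simp
  rw [Finset.sum_congr rfl h1, Finset.sum_const, card_multiIndex_eq hn', nsmul_eq_mul, ← mul_assoc,
    ← mul_assoc]
  have h2 : (∏ x, (Nat.factorial (n x) : ℂ)) * (Nat.multinomial Finset.univ n : ℂ) =
      Nat.factorial k := by
    have := Nat.multinomial_spec Finset.univ n
    rw [hn'] at this
    exact_mod_cast this
  rw [mul_assoc _ _ (∏ x, (Nat.factorial (n x) : ℂ)), mul_comm (Nat.multinomial _ n : ℂ), h2,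
    inv_mul_cancel₀ (by exact_mod_cast Nat.factorial_ne_zero k), one_mul]

/-- Along a ray through the origin, the derivatives of `f` are its homogeneous Taylor
components. -/
lemma iteratedDeriv_ray (hf : ContDiffAt ℂ ∞ f 0) (k : ℕ) (w : X → ℂ) :
    iteratedDeriv k (fun t : ℂ => f (t • w)) 0 = homPoly (jet k f) w := by
  have htend : Tendsto (fun t : ℂ => t • w) (𝓝 0) (𝓝 0) := by
    have : Continuous fun t : ℂ => t • w := by fun_prop
    simpa using this.tendsto 0
  have hray : ∀ {f : (X → ℂ) → ℂ}, ContDiffAt ℂ ∞ f 0 →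
      ContDiffAt ℂ ∞ (fun t : ℂ => f (t • w)) 0 := by
    intro f hf
    refine ContDiffAt.comp (g := f) (f := fun t : ℂ => t • w) 0 ?_ (by fun_prop)
    simpa using hf
  induction k generalizing f with
  | zero => simp [homPoly, jet]
  | succ k ih =>
    rw [iteratedDeriv_succ']
    have h1 : deriv (fun t : ℂ => f (t • w)) =ᶠ[𝓝 0]
        fun t => ∑ x, w x * partialDeriv x f (t • w) := by
      filter_upwards [htend.eventually (eventually_differentiableAt hf)] with t ht
      have h2 : HasDerivAt (fun t : ℂ => t • w) w t := by
        simpa using (hasDerivAt_id t).smul_const w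
      have h3 : deriv (fun t : ℂ => f (t • w)) t = _ :=
        ((hasFDerivAt_dualVec_partialDeriv ht).comp_hasDerivAt t h2).deriv
      rw [h3, dualVec_apply]
      exact Finset.sum_congr rfl fun x _ => mul_comm _ _
    rw [h1.iteratedDeriv_eq, iteratedDeriv_fun_sum fun x _ => ?_]
    · have h3 : ∀ x, iteratedDeriv k (fun t : ℂ => w x * partialDeriv x f (t • w)) 0 =
          w x * homPoly (jet k (partialDeriv x f)) w := by
        intro x
        rw [← ih (contDiffAt_partialDeriv hf x), iteratedDeriv_const_mul_field]
      rw [Finset.sum_congr rfl fun x _ => h3 x, homPoly,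
        ← (Fin.insertNthEquiv (fun _ => X) (Fin.last k)).sum_comp, Fintype.sum_prod_type]
      refine Finset.sum_congr rfl fun x _ => ?_
      rw [homPoly, Finset.mul_sum]
      refine Finset.sum_congr rfl fun v _ => ?_
      simp only [Fin.insertNthEquiv, Equiv.coe_fn_mk, jet_insertNth hf,
        Fin.prod_univ_succAbove _ (Fin.last k), Fin.insertNth_apply_same,
        Fin.insertNth_apply_succAbove]
      ring
    · exact (contDiffAt_const.mul (hray (contDiffAt_partialDeriv hf x))).of_le
        (WithTop.coe_le_coe.2 le_top)

end TaylorCoeff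

end

/-! ### The Taylor series of the logarithm of the partition function -/

section

open scoped ContDiff ComplexOrder

section Degree

variable {X : Type*} [Fintype X] [DecidableEq X]

/-- A convergent series over multi-indices may be summed by total degree. -/
lemma HasSum.sum_piAntidiag {E : Type*} [NormedAddCommGroup E] {a : (X → ℕ) → E} {s : E}
    (h : HasSum a s) : HasSum (fun k => ∑ n ∈ Finset.piAntidiag Finset.univ k, a n) s := by
  have h1 := ((Equiv.sigmaFiberEquiv fun n : X → ℕ => ∑ x, n x).hasSum_iff (f := a)).2 h
  refine h1.sigma fun k => ?_
  have h2 := Finset.hasSum (Finset.piAntidiag Finset.univ k) a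
  exact ((Equiv.subtypeEquivRight (by simp) : {n : X → ℕ // ∑ x, n x = k} ≃
    ((Finset.piAntidiag Finset.univ k : Finset (X → ℕ)) : Set (X → ℕ))).hasSum_iff).2 h2

lemma sum_le_sum_piAntidiag {a : (X → ℕ) → ℝ} (ha : ∀ n, 0 ≤ a n) (A : Finset (X → ℕ)) :
    ∃ N, ∑ n ∈ A, a n ≤ ∑ k ∈ Finset.range (N + 1), ∑ n ∈ Finset.piAntidiag Finset.univ k, a n := by
  refine ⟨A.sup fun n => ∑ x, n x, ?_⟩
  rw [← Finset.sum_fiberwise_of_maps_to (g := fun n => ∑ x, n x)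
    (t := Finset.range ((A.sup fun n => ∑ x, n x) + 1))
    (fun n hn => by simpa [Nat.lt_succ_iff] using Finset.le_sup (f := fun n => ∑ x, n x) hn)]
  refine Finset.sum_le_sum fun k _ => Finset.sum_le_sum_of_subset_of_nonneg ?_ fun n _ _ => ha n
  intro n hn
  simpa using (Finset.mem_filter.1 hn).2

end Degree

namespace RepulsiveLatticeGas

variable {X : Type*} [Fintype X] [DecidableEq X] (G : RepulsiveLatticeGas X)

lemma contDiffAt_logZ : ContDiffAt ℂ ∞ (fun v : X → ℂ => Complex.log (G.Z v)) 0 :=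
  (Complex.contDiffAt_log (by simp)).comp 0 G.contDiff_Z.contDiffAt

/-- The Taylor coefficients of `log Z(w)` and of `-log Z(-w)` agree up to an alternating sign. -/
lemma taylorCoeff_logZ (n : X → ℕ) : taylorCoeff (fun v : X → ℂ => Complex.log (G.Z v)) n =
    -(∏ x, (-1 : ℂ) ^ n x) * taylorCoeff G.negLogZ n := by
  obtain ⟨v, hv⟩ := exists_multiIndex_eq n
  have hL : (fun v : X → ℂ => Complex.log (G.Z v)) =
      fun w => (-1) * G.negLogZ ((fun _ => (-1 : ℂ)) * w) := by
    ext w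
    have : -((fun _ => (-1 : ℂ)) * w) = w := by ext; simp
    simp [negLogZ, this]
  rw [← hv, taylorCoeff_eq G.contDiffAt_logZ, taylorCoeff_eq G.contDiffAt_negLogZ, hL,
    jet_const_mul, jet_comp_mul G.contDiffAt_negLogZ,
    prod_eq_prod_pow_multiIndex v fun _ => (-1 : ℂ)]
  ring

lemma taylorCoeff_negLogZ_nonneg (n : X → ℕ) : 0 ≤ taylorCoeff G.negLogZ n := by
  obtain ⟨v, hv⟩ := exists_multiIndex_eq n
  rw [← hv, taylorCoeff_eq G.contDiffAt_negLogZ]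
  refine mul_nonneg ?_ (G.nonnegJet_negLogZ _ _ le_rfl v)
  exact inv_nonneg.2 (Finset.prod_nonneg fun x _ => Nat.cast_nonneg _)

/-- At a point with nonpositive coordinates every term of the series of `log Z` is nonpositive. -/
lemma logZTerm_neg (R : X → ℝ) (n : X → ℕ) : G.logZTerm (fun x => -(R x : ℂ)) n =
    -(taylorCoeff G.negLogZ n * ∏ x, (R x : ℂ) ^ n x) := by
  rw [logZTerm, taylorCoeff_logZ]
  have : ∀ x, (-(R x : ℂ)) ^ n x = (-1) ^ n x * (R x : ℂ) ^ n x := fun x => neg_pow _ _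
  simp only [this, Finset.prod_mul_distrib]
  have h2 : (∏ x, (-1 : ℂ) ^ n x) * (∏ x, (-1 : ℂ) ^ n x) = 1 := by
    rw [← Finset.prod_mul_distrib]
    exact Finset.prod_eq_one fun x _ => by rw [← mul_pow]; norm_num
  linear_combination (-taylorCoeff G.negLogZ n * ∏ x, (R x : ℂ) ^ n x) * h2

lemma logZTerm_neg_eq_norm {R : X → ℝ} (hR : ∀ x, 0 ≤ R x) (n : X → ℕ) :
    G.logZTerm (fun x => -(R x : ℂ)) n = -(‖G.logZTerm (fun x => -(R x : ℂ)) n‖ : ℂ) := by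
  have h : 0 ≤ taylorCoeff G.negLogZ n * ∏ x, (R x : ℂ) ^ n x :=
    mul_nonneg (G.taylorCoeff_negLogZ_nonneg n) (Finset.prod_nonneg fun x _ =>
      pow_nonneg (Complex.zero_le_real.2 (hR x)) _)
  rw [logZTerm_neg, norm_neg, ← Complex.eq_coe_norm_of_nonneg h]

lemma norm_logZTerm_le {R : X → ℝ} {w : X → ℂ} (hw : ∀ x, ‖w x‖ ≤ R x) (n : X → ℕ) :
    ‖G.logZTerm w n‖ ≤ ‖G.logZTerm (fun x => -(R x : ℂ)) n‖ := by
  rw [logZTerm, logZTerm, norm_mul, norm_mul, norm_prod, norm_prod]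
  gcongr with x
  rw [norm_pow, norm_pow]
  gcongr
  rw [norm_neg, Complex.norm_real]
  exact (hw x).trans (le_abs_self _)

/-- The partial sums by degree of the series of `-log Z` at `-R` are Taylor polynomials. -/
lemma sum_norm_logZTerm_eq {R : X → ℝ} (hR : ∀ x, 0 ≤ R x) (N : ℕ) :
    ∑ k ∈ Finset.range (N + 1), ∑ n ∈ Finset.piAntidiag Finset.univ k,
      ‖G.logZTerm (fun x => -(R x : ℂ)) n‖ = taylorPoly N G.negLogZ R := by
  rw [taylorPoly]
  refine Finset.sum_congr rfl fun k _ => ?_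
  have h1 := homPoly_jet_eq_sum G.contDiffAt_negLogZ k fun x => (R x : ℂ)
  have h2 : homPoly (jet k G.negLogZ) (fun x => (R x : ℂ)) =
      ((homPoly (fun v => (jet k G.negLogZ v).re) R : ℝ) : ℂ) := by
    rw [homPoly, homPoly]
    push_cast
    refine Finset.sum_congr rfl fun v _ => ?_
    rw [← Complex.eq_re_of_ofReal_le (r := 0) (by simpa using G.nonnegJet_negLogZ k k le_rfl v)]
  rw [h2] at h1
  apply Complex.ofReal_injective
  push_cast
  rw [h1]
  refine Finset.sum_congr rfl fun n _ => ?_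
  rw [← neg_inj, ← G.logZTerm_neg_eq_norm hR, logZTerm_neg]

/-- Positivity of `Z` on the box `[-R, 0]` makes the series of `log Z` absolutely convergent at its
corner. -/
theorem summable_norm_logZTerm {R : X → ℝ} (hR : ∀ x, 0 ≤ R x)
    (h : ∀ w ∈ Set.Icc 0 R, 0 < G.Z (-w)) :
    Summable fun n => ‖G.logZTerm (fun x => -(R x : ℂ)) n‖ := by
  refine summable_of_sum_le (c := -Real.log (G.Z (-R))) (fun _ => norm_nonneg _) fun A => ?_
  obtain ⟨N, hN⟩ := sum_le_sum_piAntidiag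
    (a := fun n => ‖G.logZTerm (fun x => -(R x : ℂ)) n‖) (fun _ => norm_nonneg _) A
  refine hN.trans ?_
  rw [G.sum_norm_logZTerm_eq hR]
  exact G.taylorPoly_negLogZ_le hR h N

/-- Wherever the Taylor series of `log Z` converges absolutely, its sum is a logarithm of `Z`.  Both
sides are analytic along the segment from the origin, and they agree near the origin. -/
theorem exp_tsum_logZTerm {w : X → ℂ} (h : Summable fun n => ‖G.logZTerm w n‖) :
    Complex.exp (∑' n, G.logZTerm w n) = G.Z w := by
  set L : (X → ℂ) → ℂ := fun v => Complex.log (G.Z v) with hL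
  set q : ℕ → ℂ := fun k => ∑ n ∈ Finset.piAntidiag Finset.univ k, G.logZTerm w n with hq
  have hqs : Summable fun k => ‖q k‖ :=
    .of_nonneg_of_le (fun _ => norm_nonneg _) (fun k => norm_sum_le _ _)
      h.hasSum.sum_piAntidiag.summable
  have hqtsum : ∑' k, q k = ∑' n, G.logZTerm w n := h.of_norm.hasSum.sum_piAntidiag.tsum_eq
  set Q : ℂ → ℂ := fun t => ∑' k, q k * t ^ k with hQ
  have hbd : ∀ k, ∀ t ∈ Metric.closedBall (0 : ℂ) 1, ‖q k * t ^ k‖ ≤ ‖q k‖ := by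
    intro k t ht
    rw [norm_mul, norm_pow]
    exact mul_le_of_le_one_right (norm_nonneg _)
      (pow_le_one₀ (norm_nonneg _) (by simpa using ht))
  have hQc : ContinuousOn Q (Metric.closedBall 0 1) :=
    continuousOn_tsum (fun k => by fun_prop) hqs hbd
  have hQd : DifferentiableOn ℂ Q (Metric.ball 0 1) :=
    Complex.differentiableOn_tsum_of_summable_norm hqs (fun k => by fun_prop) Metric.isOpen_ball
      fun k t ht => hbd k t (Metric.ball_subset_closedBall ht)
  have hray : ∀ t : ℂ, HasDerivAt (fun t : ℂ => t • w) w t := fun t => by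
    simpa using (hasDerivAt_id t).smul_const w
  have hZd : Differentiable ℂ fun t : ℂ => G.Z (t • w) := fun t => by
    have h1 := (G.hasFDerivAt_Z (t • w)).comp_hasDerivAt t (hray t)
    exact h1.differentiableAt
  have hnear : (fun t => Complex.exp (Q t)) =ᶠ[𝓝 0] fun t => G.Z (t • w) := by
    have hlog : ∀ᶠ t : ℂ in 𝓝 0, DifferentiableAt ℂ (fun t : ℂ => L (t • w)) t ∧
        G.Z (t • w) ≠ 0 := by
      have h1 : ContinuousAt (fun t : ℂ => G.Z (t • w)) 0 := hZd.continuous.continuousAt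
      filter_upwards [h1.eventually (Complex.isOpen_slitPlane.mem_nhds (by simp))] with t ht
      exact ⟨(hZd t).clog ht, Complex.slitPlane_ne_zero ht⟩
    obtain ⟨r, hr, hball⟩ := Metric.eventually_nhds_iff_ball.1 hlog
    filter_upwards [Metric.ball_mem_nhds (0 : ℂ) hr] with t ht
    have hT := Complex.hasSum_taylorSeries_on_ball (f := fun t : ℂ => L (t • w)) (c := 0)
      (r := r) (fun t ht => (hball t ht).1.differentiableWithinAt) ht
    have hterm : ∀ k, ((Nat.factorial k : ℂ))⁻¹ • (t - 0) ^ k •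
        iteratedDeriv k (fun t : ℂ => L (t • w)) 0 = q k * t ^ k := by
      intro k
      rw [iteratedDeriv_ray G.contDiffAt_logZ, hq]
      simp only [logZTerm]
      rw [← homPoly_jet_eq_sum G.contDiffAt_logZ]
      simp only [smul_eq_mul, sub_zero]
      ring
    simp only [hterm] at hT
    simp only [hQ]
    rw [hT.tsum_eq, hL, Complex.exp_log (hball t ht).2]
  have hopen : Set.EqOn (fun t => Complex.exp (Q t)) (fun t => G.Z (t • w))
      (Metric.ball 0 1) := by
    refine AnalyticOnNhd.eqOn_of_preconnected_of_eventuallyEq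
      (hQd.cexp.analyticOnNhd Metric.isOpen_ball)
      (hZd.differentiableOn.analyticOnNhd Metric.isOpen_ball)
      (convex_ball (0 : ℂ) 1).isPreconnected (Metric.mem_ball_self one_pos) hnear
  -- The point of interest `t = 1` lies on the boundary of the disc and is reached by continuity.
  have hclosed := hopen.of_subset_closure (t := Metric.closedBall 0 1) hQc.cexp
    hZd.continuous.continuousOn Metric.ball_subset_closedBall
    (by rw [closure_ball (0 : ℂ) one_ne_zero])
  have h1 := hclosed (x := 1) (by simp)
  simp only [hQ, one_pow, mul_one, one_smul] at h1
  rw [← hqtsum, h1]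

/-- If the series of `log Z` converges absolutely at `-R`, then `|Z|` is smallest at `-R` among all
points of the closed polydisc of polyradius `R`. -/
theorem Z_neg_le_norm_Z {R : X → ℝ} (hR : ∀ x, 0 ≤ R x)
    (h : Summable fun n => ‖G.logZTerm (fun x => -(R x : ℂ)) n‖) {w : X → ℂ}
    (hw : ∀ x, ‖w x‖ ≤ R x) : 0 < G.Z (-R) ∧ G.Z (-R) ≤ ‖G.Z w‖ := by
  have h1 := G.exp_tsum_logZTerm h
  have h2 : ∑' n, G.logZTerm (fun x => -(R x : ℂ)) n =
      ((-∑' n, ‖G.logZTerm (fun x => -(R x : ℂ)) n‖ : ℝ) : ℂ) := by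
    rw [Complex.ofReal_neg, Complex.ofReal_tsum, ← tsum_neg]
    exact tsum_congr fun n => G.logZTerm_neg_eq_norm hR n
  have h3 : (fun x => -(R x : ℂ)) = fun x => (((-R) x : ℝ) : ℂ) := by ext; simp
  have h4 : Real.exp (-∑' n, ‖G.logZTerm (fun x => -(R x : ℂ)) n‖) = G.Z (-R) := by
    rw [h2] at h1
    apply Complex.ofReal_injective
    rw [Complex.ofReal_exp, h1, h3, Z_ofReal]
  have hws : Summable fun n => ‖G.logZTerm w n‖ :=
    .of_nonneg_of_le (fun _ => norm_nonneg _) (G.norm_logZTerm_le hw) h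
  rw [← h4, ← G.exp_tsum_logZTerm hws, Complex.norm_exp]
  refine ⟨Real.exp_pos _, Real.exp_le_exp.2 ?_⟩
  have h5 : ‖∑' n, G.logZTerm w n‖ ≤ ∑' n, ‖G.logZTerm (fun x => -(R x : ℂ)) n‖ :=
    (norm_tsum_le_tsum_norm hws).trans (hws.tsum_le_tsum (G.norm_logZTerm_le hw) h)
  have h6 := Complex.abs_re_le_norm (∑' n, G.logZTerm w n)
  have h7 := neg_abs_le (∑' n, G.logZTerm w n).re
  linarith

/-- The terms of the series at `-R` all have the same sign, so that convergence of any exhausting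
sequence of partial sums forces absolute convergence. -/
lemma summable_norm_of_convergesAlongSomeExhaustion {R : X → ℝ} (hR : ∀ x, 0 ≤ R x)
    (h : ConvergesAlongSomeExhaustion (G.logZTerm (fun x => -(R x : ℂ)))) :
    Summable fun n => ‖G.logZTerm (fun x => -(R x : ℂ)) n‖ := by
  obtain ⟨A, hA, hex, s, hs⟩ := h
  have hre : Tendsto (fun k => ∑ n ∈ A k, ‖G.logZTerm (fun x => -(R x : ℂ)) n‖) atTop
      (𝓝 (-s.re)) := by
    have h1 := ((Complex.continuous_re.tendsto s).comp hs).neg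
    refine h1.congr fun k => ?_
    rw [Function.comp_apply, Complex.re_sum, ← Finset.sum_neg_distrib]
    refine Finset.sum_congr rfl fun n _ => ?_
    rw [G.logZTerm_neg_eq_norm hR n, Complex.neg_re, Complex.ofReal_re, neg_neg, norm_neg,
      Complex.norm_real, norm_norm]
  have hmono : Monotone fun k => ∑ n ∈ A k, ‖G.logZTerm (fun x => -(R x : ℂ)) n‖ := fun i j hij =>
    Finset.sum_le_sum_of_subset_of_nonneg (hA hij) fun _ _ _ => norm_nonneg _
  refine summable_of_sum_le (c := -s.re) (fun _ => norm_nonneg _) fun B => ?_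
  obtain ⟨k, hk⟩ : ∃ k, B ⊆ A k := by
    induction B using Finset.induction_on with
    | empty => exact ⟨0, by simp⟩
    | insert n B _ ih =>
      obtain ⟨k, hk⟩ := ih
      obtain ⟨l, hl⟩ := hex n
      exact ⟨max k l, Finset.insert_subset (hA (le_max_right k l) hl)
        (hk.trans (hA (le_max_left k l)))⟩
  exact (Finset.sum_le_sum_of_subset_of_nonneg hk fun _ _ _ => norm_nonneg _).trans
    (hmono.ge_of_tendsto hre k)

end RepulsiveLatticeGas

end

/-! ### Hard-core self-repulsion -/

section Moebius

variable {X : Type*} [DecidableEq X]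

lemma sum_powerset_neg_one_pow_card_real (S : Finset X) :
    ∑ T ∈ S.powerset, (-1 : ℝ) ^ T.card = if S = ∅ then 1 else 0 := by
  have := Finset.sum_powerset_neg_one_pow_card (x := S)
  exact_mod_cast this

lemma sum_neg_one_pow_card_between [Fintype X] (S U : Finset X) :
    ∑ T : Finset X with S ⊆ T ∧ T ⊆ U, (-1 : ℝ) ^ T.card =
      if U = S then (-1 : ℝ) ^ S.card else 0 := by
  by_cases h : S ⊆ U
  · have h1 : Finset.univ.filter (fun T : Finset X => S ⊆ T ∧ T ⊆ U) = Finset.Icc S U := by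
      ext; simp
    rw [h1, Finset.Icc_eq_image_powerset h, Finset.sum_image]
    · have h2 : ∀ V ∈ (U \ S).powerset, (-1 : ℝ) ^ (S ∪ V).card =
          (-1) ^ S.card * (-1) ^ V.card := by
        intro V hV
        rw [Finset.card_union_of_disjoint, pow_add]
        exact Finset.disjoint_of_subset_right (Finset.mem_powerset.1 hV) Finset.disjoint_sdiff
      rw [Finset.sum_congr rfl h2, ← Finset.mul_sum, sum_powerset_neg_one_pow_card_real]
      by_cases hU : U = S
      · simp [hU]
      · have : U \ S ≠ ∅ := fun h3 =>
          hU ((Finset.sdiff_eq_empty_iff_subset.1 h3).antisymm h)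
        simp [hU, this]
    · intro V hV V' hV' hVV
      have hd : ∀ {V}, V ∈ (U \ S).powerset → (S ∪ V) \ S = V := by
        intro V hV
        rw [Finset.union_sdiff_left, Finset.sdiff_eq_self_of_disjoint]
        exact Finset.disjoint_of_subset_left (Finset.mem_powerset.1 hV) Finset.sdiff_disjoint
      rw [← hd hV, ← hd hV']
      simp only at hVV
      rw [hVV]
  · rw [if_neg (by rintro rfl; exact h le_rfl), Finset.filter_false_of_mem, Finset.sum_empty]
    exact fun T _ hT => h (hT.1.trans hT.2)

/-- Möbius inversion on the lattice of subsets: `a ↦ (-1)^|S| ∑_{T ⊇ S} a T` is an involution. -/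
lemma sum_superset_neg_one_pow_mul [Fintype X] (a : Finset X → ℝ) (S : Finset X) :
    ∑ T : Finset X with S ⊆ T, (-1 : ℝ) ^ T.card * ∑ U : Finset X with T ⊆ U, a U =
      (-1) ^ S.card * a S := by
  simp only [Finset.mul_sum]
  rw [Finset.sum_comm' (t' := Finset.univ)
    (s' := fun U => Finset.univ.filter fun T => S ⊆ T ∧ T ⊆ U) (by simp)]
  simp only [← Finset.sum_mul, sum_neg_one_pow_card_between, ite_mul, zero_mul]
  simp

end Moebius

namespace RepulsiveLatticeGas

section HardCore

variable {X : Type*} [Fintype X] [DecidableEq X] (G : RepulsiveLatticeGas X)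

lemma pairProd_empty : G.pairProd ∅ = 1 := by simp [pairProd]

lemma pairProd_insert {x : X} {S : Finset X} (hx : x ∉ S) :
    G.pairProd (insert x S) = (∏ y ∈ S, G.W x y) * G.pairProd S := by
  rw [pairProd, pairProd, Finset.sym2_insert, Finset.filter_union, Finset.prod_union]
  · congr 1
    have h1 : ((insert x S).image fun b => s(x, b)).filter (fun e => ¬ e.IsDiag) =
        S.image fun b => s(x, b) := by
      ext e
      simp only [Finset.mem_filter, Finset.mem_image, Finset.mem_insert]
      constructor
      · rintro ⟨⟨y, rfl | hy, rfl⟩, he⟩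
        · simp at he
        · exact ⟨y, hy, rfl⟩
      · rintro ⟨y, hy, rfl⟩
        exact ⟨⟨y, Or.inr hy, rfl⟩, by
          rw [Sym2.mk_isDiag_iff]
          rintro rfl
          exact hx hy⟩
    rw [h1, Finset.prod_image (by simp)]
    rfl
  · rw [Finset.disjoint_left]
    intro e he he'
    simp only [Finset.mem_filter, Finset.mem_image] at he he'
    obtain ⟨⟨y, -, rfl⟩, -⟩ := he
    exact hx (Finset.mk_mem_sym2_iff.1 he'.1).1

/-- The weight `∏_{x ∈ S} w_x ∏_{{x, y} ⊆ S} W(x, y)` of a set of particles. -/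
def setWeight (w : X → ℝ) (S : Finset X) : ℝ := (∏ x ∈ S, w x) * G.pairProd S

lemma setWeight_insert (w : X → ℝ) {x : X} {S : Finset X} (hx : x ∉ S) :
    G.setWeight w (insert x S) = w x * G.setWeight (G.damp x w) S := by
  rw [setWeight, setWeight, G.pairProd_insert hx, Finset.prod_insert hx]
  simp only [damp, Finset.prod_mul_distrib, RCLike.ofReal_real_eq_id, id]
  ring

lemma setWeight_neg (R : X → ℝ) (S : Finset X) :
    G.setWeight (-R) S = (-1) ^ S.card * ((∏ x ∈ S, R x) * G.pairProd S) := by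
  have : ∏ x ∈ S, (-R) x = (-1) ^ S.card * ∏ x ∈ S, R x := by
    simp [Finset.prod_neg]
  rw [setWeight, this, mul_assoc]

lemma setWeight_eq_zero {w : X → ℝ} {x : X} {S : Finset X} (hx : x ∈ S) (hw : w x = 0) :
    G.setWeight w S = 0 := by
  rw [setWeight, Finset.prod_eq_zero hx hw, zero_mul]

lemma sum_mem_eq_sum_notMem_insert (x : X) (F : Finset X → ℝ) :
    ∑ Y : Finset X with x ∈ Y, F Y = ∑ Y : Finset X with x ∉ Y, F (insert x Y) := by
  refine Finset.sum_bij' (fun Y _ => Y.erase x) (fun Y _ => insert x Y) ?_ ?_ ?_ ?_ ?_ <;>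
    simp +contextual [Finset.insert_erase]

variable (hG : ∀ x, G.W x x = 0)

include hG

lemma damp_self (x : X) (w : X → ℝ) : G.damp x w x = 0 := by simp [damp, hG]

lemma ZSup_insert (w : X → ℝ) {x : X} {S : Finset X} (hx : x ∉ S) :
    G.ZSup w (insert x S) = w x * G.ZSup (G.damp x w) S := by
  have h1 : ∀ (w : X → ℝ) (S : Finset X), G.ZSup w S =
      ∑ Y : Finset X, if S ⊆ Y then G.setWeight w Y else 0 := by
    intro w S
    rw [ZSup, Finset.sum_filter]
    rfl
  rw [h1, h1, Finset.mul_sum, ← Finset.sum_filter_add_sum_filter_not _ (fun Y => x ∈ Y),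
    ← Finset.sum_filter_add_sum_filter_not _ (fun Y => x ∈ Y) (fun Y => w x * _),
    sum_mem_eq_sum_notMem_insert, add_comm]
  congr 1
  · rw [Finset.sum_eq_zero, Finset.sum_eq_zero]
    · intro Y hY
      rw [G.setWeight_eq_zero (Finset.mem_filter.1 hY).2 (G.damp_self hG x w)]
      simp
    · intro Y hY
      rw [if_neg]
      exact fun h => (Finset.mem_filter.1 hY).2 (h (Finset.mem_insert_self x S))
  · refine Finset.sum_congr rfl fun Y hY => ?_
    have hxY := (Finset.mem_filter.1 hY).2
    rw [G.setWeight_insert w hxY]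
    have : insert x S ⊆ insert x Y ↔ S ⊆ Y := by
      rw [Finset.insert_subset_insert_iff hx]
    simp [this]

lemma ZSup_empty_eq (w : X → ℝ) (x : X) : G.ZSup w ∅ =
    G.ZSup (Function.update w x 0) ∅ + w x * G.ZSup (G.damp x w) ∅ := by
  rw [← G.ZSup_insert hG w (Finset.notMem_empty x)]
  have h1 : ∀ (w : X → ℝ), G.ZSup w ∅ = ∑ Y : Finset X, G.setWeight w Y := by
    intro w
    simp [ZSup, setWeight]
  have h2 : G.ZSup w (insert x ∅) = ∑ Y : Finset X with x ∈ Y, G.setWeight w Y := by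
    simp [ZSup, setWeight]
  rw [h1, h1, h2, ← Finset.sum_filter_add_sum_filter_not _ (fun Y => x ∈ Y), add_comm,
    ← Finset.sum_filter_add_sum_filter_not _ (fun Y => x ∈ Y)
      (fun Y => G.setWeight (Function.update w x 0) Y)]
  congr 1
  rw [Finset.sum_eq_zero (s := Finset.filter (fun Y => x ∈ Y) _)
    (f := fun Y => G.setWeight (Function.update w x 0) Y) fun Y hY => ?_, zero_add]
  · refine Finset.sum_congr rfl fun Y hY => ?_
    rw [setWeight, setWeight]
    congr 1
    refine Finset.prod_congr rfl fun y hy => ?_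
    rw [Function.update_of_ne]
    rintro rfl
    exact (Finset.mem_filter.1 hY).2 hy
  · exact G.setWeight_eq_zero (Finset.mem_filter.1 hY).2 (by simp)

lemma hasFDerivAt_ZSup (w : X → ℝ) :
    HasFDerivAt (fun w => G.ZSup w ∅) (dualVec fun x => G.ZSup (G.damp x w) ∅) w := by
  have h1 : ∀ S : Finset X, HasFDerivAt (fun w : X → ℝ => (∏ x ∈ S, w x) * G.pairProd S)
      (G.pairProd S • ∑ x ∈ S, (∏ y ∈ S.erase x, w y) •
        ContinuousLinearMap.proj (R := ℝ) (φ := fun _ : X => ℝ) x) w := by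
    intro S
    refine HasFDerivAt.mul_const ?_ _
    refine HasFDerivAt.finsetProd fun x _ => ?_
    exact (ContinuousLinearMap.proj (R := ℝ) (φ := fun _ : X => ℝ) x).hasFDerivAt
  have h2 := HasFDerivAt.fun_sum (u := Finset.univ) fun S _ => h1 S
  have h3 : (fun w => G.ZSup w ∅) = fun w => ∑ S : Finset X, (∏ x ∈ S, w x) * G.pairProd S := by
    ext w; simp [ZSup]
  rw [h3]
  refine h2.congr_fderiv ?_
  ext e
  simp only [sum_apply, smul_apply, ContinuousLinearMap.proj_apply, smul_eq_mul, dualVec_apply,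
    Finset.mul_sum]
  rw [Finset.sum_comm' (t' := Finset.univ) (s' := fun x => Finset.univ.filter (x ∈ ·)) (by simp)]
  refine Finset.sum_congr rfl fun x _ => ?_
  rw [sum_mem_eq_sum_notMem_insert, ZSup, Finset.sum_mul, Finset.sum_filter]
  simp only [Finset.empty_subset, Finset.filter_true]
  refine Finset.sum_congr rfl fun Y _ => ?_
  by_cases hx : x ∈ Y
  · have := G.setWeight_eq_zero hx (G.damp_self hG x w)
    rw [setWeight] at this
    simp [hx, this]
  · rw [if_pos hx, Finset.erase_insert hx, G.pairProd_insert hx]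
    simp only [damp, Finset.prod_mul_distrib, RCLike.ofReal_real_eq_id, id]
    ring

/-- With hard-core self-repulsion `Z` is the finite sum over sets of particles.  Both sides solve
`∂f/∂w_x (w) = f(W(x, ·) w)`, and the vector `W(x, ·) w` has fewer nonzero coordinates than `w`. -/
theorem Z_eq_ZSup (w : X → ℝ) : G.Z w = G.ZSup w ∅ := by
  obtain ⟨n, hn⟩ : ∃ n, (Finset.univ.filter fun x => w x ≠ 0).card ≤ n := ⟨_, le_rfl⟩
  induction n generalizing w with
  | zero =>
    have hw : w = 0 := by
      ext x
      by_contra hx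
      have := Finset.card_eq_zero.1 (Nat.le_zero.1 hn)
      exact Finset.notMem_empty x (this ▸ Finset.mem_filter.2 ⟨Finset.mem_univ x, hx⟩)
    subst hw
    rw [Z_zero, ZSup, Finset.sum_eq_single ∅]
    · simp [pairProd_empty]
    · intro S _ hS
      obtain ⟨x, hx⟩ := Finset.nonempty_iff_ne_empty.2 hS
      rw [Finset.prod_eq_zero hx rfl, zero_mul]
    · simp
  | succ n ih =>
    have hd : ∀ t : ℝ, HasDerivAt (fun t : ℝ => G.Z (t • w) - G.ZSup (t • w) ∅) 0 t := by
      intro t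
      have hray : HasDerivAt (fun t : ℝ => t • w) w t := by
        simpa using (hasDerivAt_id t).smul_const w
      have h1 := ((G.hasFDerivAt_Z (t • w)).comp_hasDerivAt t hray).sub
        ((G.hasFDerivAt_ZSup hG (t • w)).comp_hasDerivAt t hray)
      refine h1.congr_deriv ?_
      rw [dualVec_apply, dualVec_apply, sub_eq_zero]
      refine Finset.sum_congr rfl fun x _ => ?_
      by_cases hx : w x = 0
      · simp [hx]
      · rw [ih]
        refine Nat.le_of_lt_succ (lt_of_lt_of_le (Finset.card_lt_card ?_) hn)
        rw [Finset.ssubset_iff_of_subset]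
        · exact ⟨x, by simpa using hx, by simp [G.damp_self hG]⟩
        · intro y hy
          simp only [damp, Finset.mem_filter, Finset.mem_univ, true_and, Pi.smul_apply,
            smul_eq_mul] at hy ⊢
          rintro h0
          simp [h0] at hy
    have hc := is_const_of_deriv_eq_zero (fun t => (hd t).differentiableAt)
      (fun t => (hd t).deriv) 1 0
    have h0 := ih 0 (by simp)
    simp only [one_smul, zero_smul, h0, sub_self] at hc
    linarith

/-- `Z` is affine in each fugacity separately. -/
lemma Z_eq_update (w : X → ℝ) (x : X) :
    G.Z w = G.Z (Function.update w x 0) + w x * G.Z (G.damp x w) := by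
  simp only [G.Z_eq_ZSup hG]
  exact G.ZSup_empty_eq hG w x

/-- A separately affine function that is positive at the vertices of a box is positive on the
box. -/
lemma Z_pos_of_vertices {R : X → ℝ} (hR : ∀ x, 0 ≤ R x)
    (h : ∀ S : Finset X, 0 < G.Z (fun x => if x ∈ S then -R x else 0)) {w : X → ℝ}
    (hw : w ∈ Set.Icc (-R) 0) : 0 < G.Z w := by
  suffices key : ∀ (T : Finset X) (w : X → ℝ), w ∈ Set.Icc (-R) 0 →
      (∀ x, x ∉ T → w x = 0 ∨ w x = -R x) → 0 < G.Z w from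
    key Finset.univ w hw (by simp)
  intro T
  induction T using Finset.induction_on with
  | empty =>
    intro w _ hw
    convert h (Finset.univ.filter fun x => w x = -R x) using 2
    ext x
    by_cases hx : w x = -R x
    · simp [hx]
    · simpa [hx] using (hw x (by simp)).resolve_right hx
  | insert x T _ ih =>
    intro w hw hwT
    have hupd : ∀ s : ℝ, -R x ≤ s → s ≤ 0 → (s = 0 ∨ s = -R x) →
        0 < G.Z (Function.update w x s) := by
      intro s hs1 hs2 hs
      refine ih _ ⟨fun y => ?_, fun y => ?_⟩ fun y hy => ?_
      · by_cases hyx : y = x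
        · subst hyx; simpa using hs1
        · simpa [hyx] using hw.1 y
      · by_cases hyx : y = x
        · subst hyx; simpa using hs2
        · simpa [hyx] using hw.2 y
      · by_cases hyx : y = x
        · subst hyx; simpa using hs
        · simpa [hyx] using hwT y (by simp [hyx, hy])
    have hdamp : ∀ s : ℝ, G.damp x (Function.update w x s) = G.damp x w := by
      intro s
      ext y
      by_cases hyx : y = x
      · subst hyx; simp [G.damp_self hG]
      · simp [damp, hyx]
    have hR' := hR x
    have h1 := hupd 0 (by linarith) le_rfl (Or.inl rfl)
    have h2 := hupd (-R x) le_rfl (by linarith) (Or.inr rfl)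
    have h3 := G.Z_eq_update hG (Function.update w x (-R x)) x
    rw [hdamp, Function.update_idem, Function.update_self] at h3
    have h4 := G.Z_eq_update hG w x
    have h5 : -R x ≤ w x := hw.1 x
    have h6 : w x ≤ 0 := hw.2 x
    rw [h4]
    rcases le_or_gt (G.Z (G.damp x w)) 0 with h7 | h7
    · nlinarith
    · nlinarith

/-- On a box where `Z` is positive the alternating sign property of `Z(w; S)` holds, since
`Z(w; S ∪ {x}) = w_x Z(W(x, ·) w; S)`. -/
lemma neg_one_pow_mul_ZSup_nonneg {R : X → ℝ} (h : ∀ w ∈ Set.Icc 0 R, 0 < G.Z (-w))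
    (S : Finset X) {w : X → ℝ} (hw : w ∈ Set.Icc 0 R) :
    0 ≤ (-1 : ℝ) ^ S.card * G.ZSup (-w) S := by
  induction S using Finset.induction_on generalizing w with
  | empty =>
    rw [← G.Z_eq_ZSup hG]
    simpa using (h w hw).le
  | insert x S hx ih =>
    rw [G.ZSup_insert hG _ hx, Finset.card_insert_of_notMem hx, damp_neg]
    have h1 := mul_nonneg (hw.1 x) (ih (G.damp_mem_Icc' (x := x) hw))
    refine h1.trans_eq ?_
    rw [Pi.neg_apply, pow_succ]
    ring

omit hG in
lemma ZSup_eq (w : X → ℝ) (S : Finset X) :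
    G.ZSup w S = ∑ T : Finset X with S ⊆ T, G.setWeight w T := rfl

omit hG in
lemma sum_superset_ZSup (R : X → ℝ) (S : Finset X) :
    ∑ T : Finset X with S ⊆ T, (-1 : ℝ) ^ T.card * G.ZSup (-R) T =
      (∏ x ∈ S, R x) * G.pairProd S := by
  simp only [ZSup_eq]
  rw [sum_superset_neg_one_pow_mul, setWeight_neg, ← mul_assoc, ← pow_add, ← two_mul, pow_mul]
  norm_num

omit hG in
lemma HasUpperSetMarginals.eq_ZSup {R : X → ℝ} {P : Finset X → ℝ}
    (hP : G.HasUpperSetMarginals R P) (S : Finset X) :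
    P S = (-1 : ℝ) ^ S.card * G.ZSup (-R) S := by
  have h1 := sum_superset_neg_one_pow_mul P S
  simp only [hP.2.2, ← setWeight_neg, ← ZSup_eq] at h1
  rw [h1, ← mul_assoc, ← pow_add, ← two_mul, pow_mul]
  norm_num

/-- `Z` at a vertex of the box is the probability of the event that a random set with law `P` is
disjoint from `S`. -/
lemma HasUpperSetMarginals.Z_vertex_pos {R : X → ℝ} {P : Finset X → ℝ}
    (hP : G.HasUpperSetMarginals R P) (S : Finset X) :
    0 < G.Z (fun x => if x ∈ S then -R x else 0) := by
  have h1 : G.Z (fun x => if x ∈ S then -R x else 0) = ∑ Y ∈ S.powerset, G.setWeight (-R) Y := by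
    rw [G.Z_eq_ZSup hG, ZSup_eq, ← Finset.sum_filter_add_sum_filter_not _ (fun Y => Y ⊆ S)]
    rw [Finset.sum_eq_zero (s := Finset.filter (fun Y => ¬ Y ⊆ S) _) fun Y hY => ?_, add_zero]
    · refine Finset.sum_congr (by ext; simp) fun Y hY => ?_
      rw [setWeight, setWeight]
      congr 1
      refine Finset.prod_congr rfl fun y hy => ?_
      simp [Finset.mem_powerset.1 hY hy]
    · obtain ⟨x, hxY, hxS⟩ := Finset.not_subset.1 (Finset.mem_filter.1 hY).2
      exact G.setWeight_eq_zero hxY (by simp [hxS])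
  have h2 : G.Z (fun x => if x ∈ S then -R x else 0) = ∑ T, if S ∩ T = ∅ then P T else 0 := by
    rw [h1]
    simp only [setWeight_neg, ← hP.2.2, Finset.mul_sum]
    rw [Finset.sum_comm' (t' := Finset.univ) (s' := fun T => (S ∩ T).powerset)
      (by simp only [Finset.mem_powerset, Finset.subset_inter_iff]; simp)]
    simp only [← Finset.sum_mul, sum_powerset_neg_one_pow_card_real, ite_mul, one_mul, zero_mul]
  rw [h2]
  refine Finset.sum_pos' (fun T _ => ?_) ⟨∅, Finset.mem_univ _, by simpa using hP.2.1⟩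
  split_ifs
  · exact hP.1.1 T
  · exact le_rfl

end HardCore

end RepulsiveLatticeGas

/-! ### The equivalences -/

theorem theorem2p10 {X : Type*} [Fintype X] [DecidableEq X]
    (G : RepulsiveLatticeGas X) (R : X → ℝ) (hR : ∀ x, 0 ≤ R x) :
    -- (a), its reformulation by connected components, (b), (c),
    -- (d) in its weakest and in its strongest (unconditional) reading, (e)
    List.TFAE [
      ∃ C : Set (X → ℝ), C ⊆ Set.Iic 0 ∧ IsConnected C ∧ 0 ∈ C ∧ -R ∈ C ∧ ∀ w ∈ C, 0 < G.Z w,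
      -R ∈ connectedComponentIn ({w : X → ℝ | 0 < G.Z w} ∩ Set.Iic 0) 0,
      ∀ w ∈ Set.Icc (-R) 0, 0 < G.Z w,
      ∀ w : X → ℂ, (∀ x, ‖w x‖ ≤ R x) → G.Z w ≠ 0,
      ConvergesAlongSomeExhaustion (G.logZTerm (fun x => -(R x : ℂ))),
      Summable (G.logZTerm (fun x => -(R x : ℂ))),
      ∀ w : X → ℂ, (∀ x, ‖w x‖ ≤ R x) → Summable (fun n : X → ℕ => ‖G.logZTerm w n‖)] ∧
    ((∀ w ∈ Set.Icc (-R) 0, 0 < G.Z w) →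
      ∀ w : X → ℂ, (∀ x, ‖w x‖ ≤ R x) → G.Z (-R) ≤ ‖G.Z w‖ ∧ 0 < G.Z (-R)) ∧
    -- hard-core self-repulsion: (b), (b'), (f), (g), and the description of the measure in (g)
    ((∀ x, G.W x x = 0) →
      List.TFAE [
        ∀ w ∈ Set.Icc (-R) 0, 0 < G.Z w,
        ∀ S : Finset X, 0 < G.Z (fun x => if x ∈ S then -R x else 0),
        0 < G.Z (-R) ∧ ∀ S : Finset X, 0 ≤ (-1 : ℝ) ^ S.card * G.ZSup (-R) S,
        ∃ P : Finset X → ℝ, G.HasUpperSetMarginals R P] ∧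
      ∀ P : Finset X → ℝ, G.HasUpperSetMarginals R P →
        (∀ S : Finset X, P S = (-1 : ℝ) ^ S.card * G.ZSup (-R) S) ∧
          P ∅ = G.Z (-R) ∧ 0 < G.Z (-R)) := by
  have hR0 : (0 : X → ℝ) ≤ R := hR
  have hRneg : -R ≤ 0 := neg_nonpos.2 hR0
  have hsum : (∀ w ∈ Set.Icc (-R) 0, 0 < G.Z w) →
      Summable fun n => ‖G.logZTerm (fun x => -(R x : ℂ)) n‖ := fun h =>
    G.summable_norm_logZTerm hR (forall_Icc_neg_iff.1 h)
  refine ⟨?_, fun h w hw => (G.Z_neg_le_norm_Z hR (hsum h) hw).symm, fun hG => ⟨?_, ?_⟩⟩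
  · tfae_have 1 → 2 := by
      rintro ⟨C, hC, hconn, h0, hRC, hpos⟩
      have hsub : C ⊆ {w : X → ℝ | 0 < G.Z w} ∩ Set.Iic 0 := fun w hw => ⟨hpos w hw, hC hw⟩
      exact hconn.isPreconnected.subset_connectedComponentIn h0 hsub hRC
    tfae_have 2 → 1 := by
      intro h
      have h0 : (0 : X → ℝ) ∈ {w : X → ℝ | 0 < G.Z w} ∩ Set.Iic 0 := by simp
      exact ⟨_, (connectedComponentIn_subset _ _).trans Set.inter_subset_right,
        isConnected_connectedComponentIn_iff.2 h0, mem_connectedComponentIn h0, h,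
        fun w hw => (connectedComponentIn_subset _ _ hw).1⟩
    tfae_have 1 → 3 := by
      rintro ⟨C, hC, hconn, h0, hRC, hpos⟩
      exact forall_Icc_neg_iff.2
        (G.Z_pos_of_connected hR0 hC hconn.isPreconnected h0 hRC hpos)
    tfae_have 3 → 1 := fun h => ⟨Set.Icc (-R) 0, fun w hw => hw.2,
      ⟨⟨0, hRneg, le_rfl⟩, (convex_Icc (-R) 0).isPreconnected⟩, ⟨hRneg, le_rfl⟩,
      ⟨le_rfl, hRneg⟩, h⟩
    tfae_have 3 → 7 := fun h w hw =>
      .of_nonneg_of_le (fun _ => norm_nonneg _) (G.norm_logZTerm_le hw) (hsum h)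
    tfae_have 7 → 6 := fun h => .of_norm (h _ fun x => by simp [abs_of_nonneg (hR x)])
    tfae_have 6 → 5 := by
      intro h
      -- any exhaustion by finite sets will do; an enumeration of the multi-indices provides one
      obtain ⟨e⟩ := nonempty_encodable (X → ℕ)
      obtain ⟨A, hA, hex⟩ : ∃ A : ℕ → Finset (X → ℕ), Monotone A ∧ ∀ i, ∃ k, i ∈ A k := by
        refine ⟨fun k =>
            (Finset.range k).biUnion fun j => (Encodable.decode (α := X → ℕ) j).toFinset,
          fun i j hij => Finset.biUnion_subset_biUnion_of_subset_left _
            (Finset.range_mono hij), fun i => ⟨Encodable.encode i + 1, ?_⟩⟩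
        simp only [Finset.mem_biUnion, Finset.mem_range]
        exact ⟨Encodable.encode i, Nat.lt_succ_self _, by simp⟩
      exact ⟨A, hA, hex, _, h.hasSum.comp (tendsto_atTop_finset_of_monotone hA hex)⟩
    tfae_have 5 → 4 := by
      intro h w hw h0
      have := G.Z_neg_le_norm_Z hR (G.summable_norm_of_convergesAlongSomeExhaustion hR h) hw
      rw [h0, norm_zero] at this
      linarith [this.1, this.2]
    tfae_have 4 → 3 := by
      intro h w hw
      have hne : ∀ v ∈ Set.Icc (-R) 0, G.Z v ≠ 0 := by
        intro v hv h0
        refine h (fun x => (v x : ℂ)) (fun x => ?_) (by rw [G.Z_ofReal, h0, Complex.ofReal_zero])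
        have h1 : v x ≤ 0 := hv.2 x
        rw [Complex.norm_real, Real.norm_of_nonpos h1]
        exact neg_le.1 (hv.1 x)
      by_contra! hneg
      obtain ⟨v, hv, h0⟩ := (convex_Icc (-R) 0).isPreconnected.intermediate_value hw
        (⟨hRneg, le_rfl⟩ : (0 : X → ℝ) ∈ Set.Icc (-R) 0) G.continuous_Z.continuousOn
        (⟨hneg, by simp⟩ : (0 : ℝ) ∈ Set.Icc (G.Z w) (G.Z 0))
      exact hne v hv h0
    tfae_finish
  · tfae_have 1 → 3 := fun h => ⟨h _ ⟨le_rfl, hRneg⟩, fun S =>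
      G.neg_one_pow_mul_ZSup_nonneg hG (forall_Icc_neg_iff.1 h) S ⟨hR0, le_rfl⟩⟩
    tfae_have 3 → 4 := by
      rintro ⟨hpos, hS⟩
      refine ⟨fun S => (-1 : ℝ) ^ S.card * G.ZSup (-R) S, ⟨hS, ?_⟩, ?_, G.sum_superset_ZSup R⟩
      · simpa [RepulsiveLatticeGas.pairProd_empty] using G.sum_superset_ZSup R ∅
      · simpa [← G.Z_eq_ZSup hG] using hpos
    tfae_have 4 → 2 := fun ⟨P, hP⟩ S => hP.Z_vertex_pos G hG S
    tfae_have 2 → 1 := fun h w hw => G.Z_pos_of_vertices hG hR h hw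
    tfae_finish
  · intro P hP
    have h0 : P ∅ = G.Z (-R) := by
      rw [hP.eq_ZSup, G.Z_eq_ZSup hG]
      simp
    exact ⟨fun S => hP.eq_ZSup G S, h0, h0 ▸ hP.2.1⟩
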